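/- Let $n\ge 0$ and let $\mathbb R^{n+2}$ carry the flat metric $\eta$ of signature $(2,n)$. Let $f$ be a linear form on $\mathbb R^{n+2}$ whose dual vector $F=\sharp f$ satisfies $F^2=\eta(F,F)=\epsilon H^2$ with $\epsilon\in\{1,-1\}$ and $H>0$. Let $P=\{f=1\}$, let $p$ be the orthogonal projection of $\mathbb R^{n+2}$ onto $P$, and identify $P$ with $\mathbb R^{n+1}$ by taking $p(0)=F/F^2$ as origin, so that $x=y-p(0)$ is the position vector of $y\in P$. Let $\Sigma_n=\{y:\eta(y,y)=0,\ f(y)=1\}=\{y\in P: x^2=-\epsilon H^{-2}\}$ be the de Sitter ($\epsilon=1$) or anti-de Sitter ($\epsilon=-1$) space with the induced metric, and $m:\Sigma_n\to\mathbb R^{n+2}$ the inclusion. Let $\square=-(d\delta+\delta d)$ denote the Laplace–de Rham operator, written $\square_{n+2}$ on $\mathbb R^{n+2}$ and $\square_\Sigma$ on $\Sigma_n$, and write $\alpha_\Sigma=m^*\alpha$. For a smooth function $\rho$ on $\Sigma_n$ and $r\in\mathbb R$, let $\rho^{(r)}(y)=\rho\big(p(0)+x/\lambda\big)\,\lambda^r$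 with $\lambda=H\sqrt{|x^2|}$, for $y\in P$ with $\operatorname{sgn}(x^2)=-\epsilon$. For a smooth one-form $h$ on $\Sigma_n$, let $h^{(r)}$ be the one-form on the same cone in $P$ that vanishes on the radial direction $x$ and satisfies $h^{(r)}_y(v)=\lambda^{r-1}h_{p(0)+x/\lambda}(v)$ for $v$ tangent to $P$ and orthogonal to $x$. Let $W=\{y\in\mathbb R^{n+2}:\operatorname{sgn}\big((p(y)-p(0))^2\big)=-\epsilon\}$. **Theorem.** $W$ is an open neighbourhood of $\Sigma_n$. Let $\chi$ be any map from smooth one-forms on $\Sigma_n$ to smooth one-forms on $\Sigma_n$ (respectively, from smooth functions on $\Sigma_n$ to smooth functions on $\Sigma_n$). Then: 1. There is a map $\varpi$ sending each smooth one-form (respectively, smooth function) $\beta$ on $\Sigma_n$ to a smooth one-form (respectively, smooth function) $\varpi(\beta)$ on $\mathbb R^{n+2}$ such that, for every $\beta$, $$\varpi(\beta)_\Sigma=\beta,\qquad (\square_{n+2}\,\varpi(\beta))_\Sigma=\square_\Sigma\beta+\chi(\beta).$$ 2. The equation $s^2+(n-3)s=1$ (respectively, $s^2+(n-1)s=1$)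 has a real solution, and for each real solution $s$ and every $\beta$, the field $p^*\varpi_\chi(\beta)$ with $$\varpi_\chi(\beta)=\beta^{(0)}-\epsilon H^{-2}\big(\chi(\beta)^{(s)}-\chi(\beta)^{(0)}\big)$$ is smooth on $W$, restricts to $\beta$ on $\Sigma_n$ (i.e. $m^*p^*\varpi_\chi(\beta)=\beta$) and satisfies $$(\square_{n+2}\,p^*\varpi_\chi(\beta))_\Sigma=\square_\Sigma\beta+\chi(\beta).$$ -/

import Mathlib

open scoped ContDiff

namespace AdSExt

noncomputable section

/-! ### The Laplace-de Rham operator of a pseudo-Riemannian metric, in coordinates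

A coordinate patch has coordinates `x : Fin d → ℝ` and a metric `g`, given by its matrix
`g x i j`. Functions are `(Fin d → ℝ) → ℝ`; one-forms and two-forms are given by their
components `a i`, `F i j` (each a function). All derivatives are taken at interior points of the
patch. The codifferential `δ = *⁻¹ d * (-1)^p` is given by its coordinate expression, minus the
divergence on the first index; it does not depend on an orientation. -/

/-- The partial derivative `∂ᵢ u`. -/
def pd {d : ℕ} (i : Fin d) (u : (Fin d → ℝ) → ℝ) (x : Fin d → ℝ) : ℝ :=
  fderiv ℝ u x (Pi.single i 1)

/-- The Riemannian volume density `√|det g|`. -/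
def volDensity {d : ℕ} (g : (Fin d → ℝ) → Matrix (Fin d) (Fin d) ℝ) (x : Fin d → ℝ) : ℝ :=
  √|(g x).det|

/-- The exterior derivative of a function, `(du)ᵢ = ∂ᵢ u`. -/
def extDer0 {d : ℕ} (u : (Fin d → ℝ) → ℝ) : Fin d → (Fin d → ℝ) → ℝ :=
  fun i => pd i u

/-- The exterior derivative of a one-form, `(da)ᵢⱼ = ∂ᵢ aⱼ - ∂ⱼ aᵢ`. -/
def extDer1 {d : ℕ} (a : Fin d → (Fin d → ℝ) → ℝ) : Fin d → Fin d → (Fin d → ℝ) → ℝ :=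
  fun i j x => pd i (a j) x - pd j (a i) x

/-- The codifferential of a one-form,
`δa = - |g|^(-1/2) ∂ᵢ (|g|^(1/2) aⁱ)`, i.e. minus the divergence of `♯a`. -/
def codiff1 {d : ℕ} (g : (Fin d → ℝ) → Matrix (Fin d) (Fin d) ℝ)
    (a : Fin d → (Fin d → ℝ) → ℝ) (x : Fin d → ℝ) : ℝ :=
  -((volDensity g x)⁻¹ * ∑ i, pd i (fun z => volDensity g z * ∑ j, (g z)⁻¹ i j * a j z) x)

/-- The codifferential of a two-form,
`(δF)ₖ = - gₖₗ |g|^(-1/2) ∂ᵢ (|g|^(1/2) F^{il})`. -/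
def codiff2 {d : ℕ} (g : (Fin d → ℝ) → Matrix (Fin d) (Fin d) ℝ)
    (F : Fin d → Fin d → (Fin d → ℝ) → ℝ) (k : Fin d) (x : Fin d → ℝ) : ℝ :=
  -∑ l, g x k l * ((volDensity g x)⁻¹ * ∑ i, pd i (fun z =>
    volDensity g z * ∑ j, ∑ m, (g z)⁻¹ i j * (g z)⁻¹ l m * F j m z) x)

/-- The Laplace-de Rham operator `□ = -(dδ + δd)` on functions (on which `δ = 0`). -/
def box0 {d : ℕ} (g : (Fin d → ℝ) → Matrix (Fin d) (Fin d) ℝ)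
    (u : (Fin d → ℝ) → ℝ) (x : Fin d → ℝ) : ℝ :=
  -codiff1 g (extDer0 u) x

/-- The Laplace-de Rham operator `□ = -(dδ + δd)` on one-forms. -/
def box1 {d : ℕ} (g : (Fin d → ℝ) → Matrix (Fin d) (Fin d) ℝ)
    (a : Fin d → (Fin d → ℝ) → ℝ) (i : Fin d) (x : Fin d → ℝ) : ℝ :=
  -(extDer0 (codiff1 g a) i x + codiff2 g (extDer1 a) i x)

/-! ### The ambient space `ℝⁿ⁺²` of signature `(2, n)` -/

/-- The space `ℝⁿ⁺²`, with its canonical coordinates. -/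
abbrev Amb (n : ℕ) : Type := Fin (n + 2) → ℝ

/-- The metric matrix `diag(1, -1, …, -1, 1)`, of signature `(2, n)`. -/
def etaMat (n : ℕ) : Matrix (Fin (n + 2)) (Fin (n + 2)) ℝ :=
  Matrix.diagonal fun α => if α = 0 ∨ α = Fin.last (n + 1) then 1 else -1

/-- The metric as a bilinear form. -/
def eta (n : ℕ) : LinearMap.BilinForm ℝ (Amb n) := (etaMat n).toBilin'

/-- The vector `♯f` metrically dual to a linear form `f`. -/
def sharp {n : ℕ} (f : Module.Dual ℝ (Amb n)) : Amb n :=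
  (etaMat n)⁻¹.mulVec fun α => f (Pi.single α 1)

/-- `♯f` represents `f`. -/
theorem eta_sharp {n : ℕ} (f : Module.Dual ℝ (Amb n)) (v : Amb n) :
    eta n (sharp f) v = f v := by
  have hdiag : IsUnit (etaMat n) := by
    rw [etaMat, Matrix.isUnit_diagonal, Pi.isUnit_iff]
    intro α
    split_ifs <;> simp
  have hT : (etaMat n).transpose = etaMat n := by simp [etaMat]
  have h1 : (etaMat n).mulVec (sharp f) = fun α => f (Pi.single α 1) := by
    rw [sharp, Matrix.mulVec_mulVec,
      Matrix.mul_nonsing_inv _ ((Matrix.isUnit_iff_isUnit_det _).1 hdiag), Matrix.one_mulVec]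
  rw [eta, Matrix.toBilin'_apply', Matrix.dotProduct_mulVec, ← Matrix.mulVec_transpose, hT, h1]
  conv_rhs => rw [pi_eq_sum_univ' v, map_sum]
  simp [dotProduct, mul_comm]

theorem eta_symm {n : ℕ} (u v : Amb n) : eta n u v = eta n v u := by
  have hT : (etaMat n).transpose = etaMat n := by simp [etaMat]
  rw [eta, Matrix.toBilin'_apply', Matrix.toBilin'_apply', Matrix.dotProduct_mulVec,
    ← Matrix.mulVec_transpose, hT, dotProduct_comm]

/-- The flat Laplace-de Rham operator `□ₙ₊₂` on functions. -/
def flatBox0 {n : ℕ} (u : Amb n → ℝ) (y : Amb n) : ℝ :=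
  box0 (fun _ => etaMat n) u y

/-- The flat Laplace-de Rham operator `□ₙ₊₂` on one-forms. -/
def flatBox1 {n : ℕ} (a : Amb n → Module.Dual ℝ (Amb n)) (y v : Amb n) : ℝ :=
  ∑ α, v α * box1 (fun _ => etaMat n) (fun β z => a z (Pi.single β 1)) α y

/-- Smoothness of a one-form of `ℝⁿ⁺²` on a set. -/
def SmoothFormOn {n : ℕ} (a : Amb n → Module.Dual ℝ (Amb n)) (N : Set (Amb n)) : Prop :=
  ∀ v : Amb n, ContDiffOn ℝ ∞ (fun y => a y v) N

/-! ### The (anti-)de Sitter space -/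

/-- A linear form `f` on `ℝⁿ⁺²` whose dual vector `F = ♯f` has square `F² = ε H²`, with `ε = ±1`
and `H > 0`. It determines the hyperplane `P = {f = 1}` and the (A)dS space `Σₙ`. -/
structure Setting (n : ℕ) where
  f : Module.Dual ℝ (Amb n)
  ε : ℝ
  H : ℝ
  ε_eq : ε = 1 ∨ ε = -1
  H_pos : 0 < H
  F_sq : eta n (sharp f) (sharp f) = ε * H ^ 2

namespace Setting

variable {n : ℕ} (S : Setting n)

/-- The normal vector `F = ♯f` of `P`. -/
def F : Amb n := sharp S.f

/-- `Σₙ`: the intersection of the null cone with the hyperplane `P = {f = 1}`. -/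
def space : Set (Amb n) := {y | eta n y y = 0 ∧ S.f y = 1}

/-- The tangent space of `Σₙ` at `y`: the vectors killed by the differentials of the two
defining equations. -/
def tangent (y : S.space) : Submodule ℝ (Amb n) :=
  LinearMap.ker (eta n (y : Amb n)) ⊓ LinearMap.ker S.f

/-- The origin of `P ≃ ℝⁿ⁺¹`: the foot `F / F²` of the perpendicular from `0` to `P`. -/
def origin : Amb n := (S.ε * S.H ^ 2)⁻¹ • S.F

theorem F_sq_ne : S.ε * S.H ^ 2 ≠ 0 := by
  have h := S.H_pos
  rcases S.ε_eq with h' | h' <;> rw [h'] <;> simp [h.ne']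

theorem f_origin : S.f S.origin = 1 := by
  rw [origin, map_smul, ← eta_sharp S.f S.F, F, S.F_sq, smul_eq_mul, inv_mul_cancel₀ S.F_sq_ne]

theorem eta_origin (v : Amb n) : eta n S.origin v = (S.ε * S.H ^ 2)⁻¹ * S.f v := by
  rw [origin, map_smul, LinearMap.smul_apply, F, eta_sharp, smul_eq_mul]

/-- On `Σₙ` the position vector of `P` has square `-ε H⁻²`. -/
theorem eta_position (y : S.space) :
    eta n ((y : Amb n) - S.origin) ((y : Amb n) - S.origin) = -(S.ε * S.H ^ 2)⁻¹ := by
  have h1 := y.2.1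
  have h2 := y.2.2
  simp only [map_sub, LinearMap.sub_apply, h1, eta_symm (y : Amb n) S.origin, eta_origin, h2,
    f_origin]
  ring

/-- The linear part `v ↦ v - f(v) F / F²` of the orthogonal projection onto `P`. -/
def projLin : Amb n →ₗ[ℝ] Amb n := LinearMap.id - S.f.smulRight S.origin

/-- The orthogonal projection `p` of `ℝⁿ⁺²` onto `P`. -/
def proj (y : Amb n) : Amb n := y + (1 - S.f y) • S.origin

/-- The orthogonal projection of `ℝⁿ⁺²` onto the tangent space of `Σₙ` at `y`: one subtracts the
components along `F` and along the position vector `y - origin`, which span the normal space. -/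
def tangentProj (y : S.space) : Amb n →ₗ[ℝ] S.tangent y :=
  LinearMap.codRestrict (S.tangent y)
    (S.projLin - ((eta n ((y : Amb n) - S.origin)
      ((y : Amb n) - S.origin))⁻¹ • eta n ((y : Amb n) - S.origin)).smulRight
        ((y : Amb n) - S.origin))
    (by
      intro v
      have h1 := y.2.1
      have h2 := y.2.2
      have h3 := S.F_sq_ne
      have h4 := S.f_origin
      have h5 : eta n (y : Amb n) S.origin = (S.ε * S.H ^ 2)⁻¹ := by
        rw [eta_symm, eta_origin, h2, mul_one]
      rw [S.eta_position y]
      constructor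
      · simp only [inv_neg, inv_inv, LinearMap.sub_apply, LinearMap.smulRight_apply,
          LinearMap.smul_apply, projLin, LinearMap.id_apply, smul_eq_mul, map_sub, map_smul,
          SetLike.mem_coe, LinearMap.mem_ker, h1, h5, eta_origin]
        generalize S.ε * S.H ^ 2 = k at h3
        field_simp
        ring
      · simp [projLin, h2, h4])

theorem tangentProj_of_mem (y : S.space) (v : S.tangent y) :
    S.tangentProj y v = v := by
  have h1 : eta n (y : Amb n) v = 0 := v.2.1
  have h2 : S.f v = 0 := v.2.2
  apply Subtype.ext
  simp [tangentProj, projLin, h1, h2, eta_origin]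

/-- Smooth functions on `Σₙ`: locally, restrictions of smooth functions of `ℝⁿ⁺²`. -/
structure ScalarField where
  toFun : S.space → ℝ
  smooth : ∀ y : S.space, ∃ N : Set (Amb n), IsOpen N ∧ (y : Amb n) ∈ N ∧
    ∃ B : Amb n → ℝ, ContDiffOn ℝ ∞ B N ∧ ∀ z : S.space, (z : Amb n) ∈ N → B z = toFun z

/-- Smooth one-forms on `Σₙ`: a linear form on each tangent space; locally, restrictions of
smooth one-forms of `ℝⁿ⁺²`. -/
structure OneForm where
  toFun : ∀ y : S.space, Module.Dual ℝ (S.tangent y)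
  smooth : ∀ y : S.space, ∃ N : Set (Amb n), IsOpen N ∧ (y : Amb n) ∈ N ∧
    ∃ B : Amb n → Module.Dual ℝ (Amb n), SmoothFormOn B N ∧
      ∀ z : S.space, (z : Amb n) ∈ N → ∀ v : S.tangent z, B z v = toFun z v

variable {S}

/-- The value of a one-form of `Σₙ` on a vector of `ℝⁿ⁺²`, as a form that vanishes on normal
vectors; for `v` tangent this is just `b_y(v)`. -/
def OneForm.lift (b : S.OneForm) (y : S.space) : Module.Dual ℝ (Amb n) :=
  b.toFun y ∘ₗ S.tangentProj y

variable (S)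

/-- A local parametrisation of `Σₙ`: an injective smooth immersion of an open set `U ⊆ ℝⁿ`
(values outside `U` are irrelevant). By equality of dimensions its image is open in `Σₙ`. -/
structure LocalParam where
  U : Set (Fin n → ℝ)
  φ : (Fin n → ℝ) → S.space
  isOpen : IsOpen U
  smooth : ContDiffOn ℝ ∞ (fun x => (φ x : Amb n)) U
  inj : Set.InjOn φ U
  imm : ∀ x ∈ U, Function.Injective (fderiv ℝ (fun x => (φ x : Amb n)) x)

variable {S}

namespace LocalParam

/-- The coordinate vector `∂ᵢφ`. -/
def coordVec (c : S.LocalParam) (i : Fin n) (x : Fin n → ℝ) : Amb n :=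
  fderiv ℝ (fun x => (c.φ x : Amb n)) x (Pi.single i 1)

/-- The metric induced on `Σₙ`, in the coordinates of a parametrisation. -/
def metric (c : S.LocalParam) (x : Fin n → ℝ) : Matrix (Fin n) (Fin n) ℝ :=
  Matrix.of fun i j => eta n (c.coordVec i x) (c.coordVec j x)

/-- The coordinate expression of `□_Σ ψ`. -/
def boxScalar (c : S.LocalParam) (ψ : S.ScalarField) (x : Fin n → ℝ) : ℝ :=
  box0 c.metric (fun z => ψ.toFun (c.φ z)) x

/-- The `i`-th component of the coordinate expression of `□_Σ b`. -/
def boxForm (c : S.LocalParam) (b : S.OneForm) (i : Fin n) (x : Fin n → ℝ) : ℝ :=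
  box1 c.metric (fun j z => b.lift (c.φ z) (c.coordVec j z)) i x

end LocalParam

/-! ### Extensions -/

/-- The function `u`, smooth on `N`, restricts to `ψ` on `Σₙ`: `m^* u = ψ`. -/
def IsScalarExtension (ψ : S.ScalarField) (N : Set (Amb n)) (u : Amb n → ℝ) : Prop :=
  ContDiffOn ℝ ∞ u N ∧ ∀ y : S.space, u y = ψ.toFun y

/-- The one-form `a`, smooth on `N`, pulls back to `b` on `Σₙ`: `m^* a = b`. -/
def IsFormExtension (b : S.OneForm) (N : Set (Amb n))
    (a : Amb n → Module.Dual ℝ (Amb n)) : Prop :=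
  SmoothFormOn a N ∧ ∀ (y : S.space) (v : S.tangent y), a y v = b.toFun y v

/-- `(□ₙ₊₂ u)_Σ = □_Σ ψ + ξ`, checked in every local parametrisation. -/
def ScalarBoxEq (u : Amb n → ℝ) (ψ ξ : S.ScalarField) : Prop :=
  ∀ (c : S.LocalParam), ∀ x ∈ c.U,
    flatBox0 u (c.φ x) = c.boxScalar ψ x + ξ.toFun (c.φ x)

/-- `(□ₙ₊₂ a)_Σ = □_Σ b + ξ` for one-forms, checked on the coordinate vectors of every local
parametrisation. -/
def FormBoxEq (a : Amb n → Module.Dual ℝ (Amb n)) (b ξ : S.OneForm) : Prop :=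
  ∀ (c : S.LocalParam), ∀ x ∈ c.U, ∀ i : Fin n,
    flatBox1 a (c.φ x) (c.coordVec i x) =
      c.boxForm b i x + ξ.lift (c.φ x) (c.coordVec i x)

variable (S)

/-- `H √|y_A y^A|` for a point of `P ≃ ℝⁿ⁺¹`, whose position vector is `y - origin`. -/
def radius (y : Amb n) : ℝ :=
  S.H * √|eta n (y - S.origin) (y - S.origin)|

/-- The point where the half-line of `P` from the origin through `y` meets `Σₙ`. -/
def radial (y : Amb n) : Amb n := S.origin + (S.radius y)⁻¹ • (y - S.origin)

/-- The cylinder, with respect to `p`, over the cone `{sgn(y_A y^A) = -ε}` of `P ≃ ℝⁿ⁺¹`. -/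
def cylinder : Set (Amb n) :=
  {y | S.ε * eta n (S.proj y - S.origin) (S.proj y - S.origin) < 0}

variable {S}

open Classical in
/-- The extension `ψ^(r)` by homogeneity of degree `r`, from `Σₙ` to `P ≃ ℝⁿ⁺¹`. A point `y` of
`P` satisfies `radial y ∈ Σₙ` exactly if `sgn(y_A y^A) = -ε`. -/
def ScalarField.hom (ψ : S.ScalarField) (r : ℝ) (y : Amb n) : ℝ :=
  if h : S.radial y ∈ S.space then ψ.toFun ⟨S.radial y, h⟩ * S.radius y ^ r else 0

open Classical in
/-- The extension `b^(r)` by homogeneity of degree `r` (for the Lie derivative along the dilations),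
from `Σₙ` to `P ≃ ℝⁿ⁺¹`: it vanishes on the radial direction and its Cartesian components are
homogeneous of degree `r - 1`. -/
def OneForm.hom (b : S.OneForm) (r : ℝ) (y : Amb n) : Module.Dual ℝ (Amb n) :=
  if h : S.radial y ∈ S.space then S.radius y ^ (r - 1) • b.lift ⟨S.radial y, h⟩ else 0

variable (S)

/-- The pullback `p^*` of functions on `P`. -/
def pullScalar (u : Amb n → ℝ) (y : Amb n) : ℝ := u (S.proj y)

/-- The pullback `p^*` of one-forms on `P`. -/
def pullForm (a : Amb n → Module.Dual ℝ (Amb n)) (y : Amb n) : Module.Dual ℝ (Amb n) :=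
  a (S.proj y) ∘ₗ S.projLin

/-- `ϖ_χ(ψ) = ψ^(0) - ε H⁻² (χ(ψ)^(s) - χ(ψ)^(0))`, on `P ≃ ℝⁿ⁺¹`. -/
def scalarExt (χ : S.ScalarField → S.ScalarField) (s : ℝ) (ψ : S.ScalarField) : Amb n → ℝ :=
  fun y => ψ.hom 0 y - S.ε * (S.H ^ 2)⁻¹ * ((χ ψ).hom s y - (χ ψ).hom 0 y)

/-- `ϖ_χ(b) = b^(0) - ε H⁻² (χ(b)^(s) - χ(b)^(0))`, on `P ≃ ℝⁿ⁺¹`. -/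
def formExt (χ : S.OneForm → S.OneForm) (s : ℝ) (b : S.OneForm) :
    Amb n → Module.Dual ℝ (Amb n) :=
  fun y => b.hom 0 y - (S.ε * (S.H ^ 2)⁻¹) • ((χ b).hom s y - (χ b).hom 0 y)

end Setting

end

end AdSExt

namespace AdSExt

/-! ### Calculus of the metric -/

/-! Write `x` for the position vector in `P`, `o` for `S.origin`, and `κ = (ε H²)⁻¹` (`kap`). At a
point of `Σₙ` the ambient space is the orthogonal sum of the tangent space and the lines of `x` and
`o`, with `η(x,x) = -κ` and `η(o,o) = κ`. An ambient trace is therefore the tangential trace, minus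
`κ⁻¹` times the `x`-`x` term, plus `κ⁻¹` times the `o`-`o` term (`trace_eq`). The tangential trace
of a derivative is compared with the intrinsic divergence through the mean curvature vector of `Σₙ`,
which is `n κ⁻¹ x` (`sum_fderiv_densVec`).

For a field pulled back from `P` the `o`-`o` term vanishes. For a field homogeneous of degree `r`,
Euler's relation evaluates the `x`-`x` term and the curvature term. Hence, on `Σₙ`, the flat
operator applied to `p^* h^(r)` is `□_Σ h - κ⁻¹ r (r + n - 1) h` for functions and `□_Σ h - κ⁻¹ r (r
+ n - 3) h` for one-forms (`ScalarHomogeneous.flatBox0_eq`, `FormHomogeneous.flatBox1_eq`). For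
one-forms the shift comes from Cartan's formula: if `a` kills `x`, then `ι_x da = r a`.

Degree `0` thus reproduces `□_Σ` exactly. In `χ(β)^(s) - χ(β)^(0)` the terms `□_Σ χ(β)` cancel and
only a multiple of `χ(β)` is left; the factor `-ε H⁻²` and the quadratic equation for `s` make this
multiple equal to one. This extension lives on the cylinder `W`. Multiplying it by a cutoff that is
`1` near `Σₙ` makes it global and, since the flat operators are local, does not affect the equation
on `Σₙ`. -/

/-- The metric as a continuous bilinear form. -/
noncomputable def etaC (n : ℕ) : Amb n →L[ℝ] Amb n →L[ℝ] ℝ := (eta n).toContinuousBilinearMap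

theorem etaC_apply {n : ℕ} (u v : Amb n) : etaC n u v = eta n u v := rfl

/-- The diagonal entries of the metric. -/
noncomputable def etaSign {n : ℕ} (α : Fin (n + 2)) : ℝ :=
  if α = 0 ∨ α = Fin.last (n + 1) then 1 else -1

theorem etaMat_eq (n : ℕ) : etaMat n = Matrix.diagonal etaSign := rfl

theorem etaSign_mul_self {n : ℕ} (α : Fin (n + 2)) : etaSign α * etaSign α = 1 := by
  unfold etaSign; split_ifs <;> norm_num

theorem abs_etaSign {n : ℕ} (α : Fin (n + 2)) : |etaSign α| = 1 := by
  unfold etaSign; split_ifs <;> norm_num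

theorem etaMat_inv (n : ℕ) : (etaMat n)⁻¹ = etaMat n := by
  refine Matrix.inv_eq_right_inv ?_
  rw [etaMat_eq, Matrix.diagonal_mul_diagonal]
  simp [etaSign_mul_self]

theorem volDensity_etaMat {n : ℕ} (z : Amb n) : volDensity (fun _ => etaMat n) z = 1 := by
  simp [volDensity, etaMat_eq, Finset.abs_prod, abs_etaSign]

theorem eta_single {n : ℕ} (α : Fin (n + 2)) (w : Amb n) :
    eta n (Pi.single α 1) w = etaSign α * w α := by
  rw [eta, Matrix.toBilin'_apply', etaMat_eq]
  simp [Matrix.mulVec_diagonal]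

section Deriv

variable {n : ℕ} {V : Type*} [NormedAddCommGroup V] [NormedSpace ℝ V]

theorem fderiv_eta {w₁ w₂ : V → Amb n} {x : V} (h₁ : DifferentiableAt ℝ w₁ x)
    (h₂ : DifferentiableAt ℝ w₂ x) (v : V) :
    fderiv ℝ (fun z => eta n (w₁ z) (w₂ z)) x v =
      eta n (fderiv ℝ w₁ x v) (w₂ x) + eta n (w₁ x) (fderiv ℝ w₂ x v) := by
  have := (etaC n).hasFDerivAt_of_bilinear h₁.hasFDerivAt h₂.hasFDerivAt
  have h := this.fderiv
  simp only [etaC_apply] at h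
  rw [h]
  simp [etaC_apply, add_comm]

theorem contDiffAt_eta {w₁ w₂ : V → Amb n} {x : V} {m : ℕ∞ω} (h₁ : ContDiffAt ℝ m w₁ x)
    (h₂ : ContDiffAt ℝ m w₂ x) : ContDiffAt ℝ m (fun z => eta n (w₁ z) (w₂ z)) x :=
  ((etaC n).contDiff.contDiffAt.comp x h₁).clm_apply h₂

end Deriv

/-! ### The derivative of the volume density -/

section Jacobi

variable {V : Type*} [NormedAddCommGroup V] [NormedSpace ℝ V] {d : ℕ}

/-- Jacobi's formula. The determinant is multilinear in the rows, so its derivative is a sum of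
determinants with one row replaced, and Cramer's rule turns each of these into adjugate entries. -/
theorem fderiv_det {g : V → Matrix (Fin d) (Fin d) ℝ} {x : V}
    (hg : ∀ i j, DifferentiableAt ℝ (fun z => g z i j) x) :
    DifferentiableAt ℝ (fun z => (g z).det) x ∧ ∀ v,
    fderiv ℝ (fun z => (g z).det) x v =
      ∑ i, ∑ j, (g x).adjugate j i * fderiv ℝ (fun z => g z i j) x v := by
  let D : ContinuousMultilinearMap ℝ (fun _ : Fin d => Fin d → ℝ) ℝ :=
    ⟨(Matrix.detRowAlternating (n := Fin d) (R := ℝ)).toMultilinearMap,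
      by exact Continuous.matrix_det continuous_id⟩
  have hg' : HasFDerivAt (fun z : V => (fun i j => g z i j : Fin d → Fin d → ℝ))
      (ContinuousLinearMap.pi fun i => ContinuousLinearMap.pi fun j =>
        fderiv ℝ (fun z => g z i j) x) x := by
    rw [hasFDerivAt_pi]
    intro i
    rw [hasFDerivAt_pi]
    intro j
    exact (hg i j).hasFDerivAt
  have h := (D.hasFDerivAt (fun i j => g x i j)).comp x hg'
  have h' : HasFDerivAt (fun z => (g z).det) _ x := h
  refine ⟨h'.differentiableAt, fun v => ?_⟩
  rw [h'.fderiv]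
  simp only [ContinuousLinearMap.comp_apply, ContinuousMultilinearMap.linearDeriv_apply]
  refine Finset.sum_congr rfl fun i _ => ?_
  change (Matrix.updateRow (g x) i (fun j => fderiv ℝ (fun z => g z i j) x v)).det = _
  rw [← Matrix.cramer_transpose_apply, Matrix.cramer_eq_adjugate_mulVec]
  simp [Matrix.mulVec, dotProduct, ← Matrix.adjugate_transpose]

theorem pd_volDensity {g : (Fin d → ℝ) → Matrix (Fin d) (Fin d) ℝ} {x : Fin d → ℝ}
    (hg : ∀ i j, DifferentiableAt ℝ (fun z => g z i j) x) (h0 : (g x).det ≠ 0) (k : Fin d) :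
    pd k (volDensity g) x =
      volDensity g x * (1 / 2 * ∑ i, ∑ j, (g x)⁻¹ j i * pd k (fun z => g z i j) x) := by
  obtain ⟨hd, hf⟩ := fderiv_det hg
  have h1 := ((hd.hasFDerivAt.abs h0).sqrt (abs_ne_zero.2 h0)).fderiv
  have hpos : 0 < √|(g x).det| := Real.sqrt_pos.2 (abs_pos.2 h0)
  have hsum : ∑ i, ∑ j, (g x)⁻¹ j i * pd k (fun z => g z i j) x =
      (g x).det⁻¹ * fderiv ℝ (fun z => (g z).det) x (Pi.single k 1) := by
    rw [hf, Finset.mul_sum]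
    refine Finset.sum_congr rfl fun i _ => ?_
    rw [Finset.mul_sum]
    refine Finset.sum_congr rfl fun j _ => ?_
    rw [Matrix.inv_def, Matrix.smul_apply, Ring.inverse_eq_inv', pd, smul_eq_mul, mul_assoc]
  rw [hsum]
  unfold pd
  change fderiv ℝ (fun z => √|(g z).det|) x _ = √|(g x).det| * _
  rw [h1]
  have hs : √|(g x).det| * √|(g x).det| = |(g x).det| := Real.mul_self_sqrt (abs_nonneg _)
  simp only [smul_apply, smul_eq_mul]
  -- The metric is indefinite, so both signs of the determinant must be allowed; the sign enters
  -- through the derivative of the absolute value.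
  rcases lt_or_gt_of_ne h0 with h | h
  · simp only [h, sign_neg, abs_of_neg] at hs hpos ⊢
    field_simp
    norm_num
    rw [pow_two, hs]
    try ring
  · simp only [h, sign_pos, abs_of_pos] at hs hpos ⊢
    field_simp
    norm_num
    rw [pow_two, hs]
    try ring

end Jacobi

/-! ### Moving frames along a parametrisation -/

theorem contDiffAt_det {V : Type*} [NormedAddCommGroup V] [NormedSpace ℝ V] {d : ℕ} {m : ℕ∞ω}
    {g : V → Matrix (Fin d) (Fin d) ℝ} {x : V}
    (hg : ∀ i j, ContDiffAt ℝ m (fun z => g z i j) x) : ContDiffAt ℝ m (fun z => (g z).det) x := by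
  simp only [Matrix.det_apply']
  exact ContDiffAt.sum fun σ _ => contDiffAt_const.mul (contDiffAt_prod fun i _ => hg _ _)

theorem contDiffAt_inv_apply {V : Type*} [NormedAddCommGroup V] [NormedSpace ℝ V] {d : ℕ}
    {m : ℕ∞ω} {g : V → Matrix (Fin d) (Fin d) ℝ} {x : V}
    (hg : ∀ i j, ContDiffAt ℝ m (fun z => g z i j) x) (h0 : (g x).det ≠ 0) (i j : Fin d) :
    ContDiffAt ℝ m (fun z => (g z)⁻¹ i j) x := by
  simp only [Matrix.inv_def, Ring.inverse_eq_inv', Matrix.smul_apply, smul_eq_mul,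
    Matrix.adjugate_apply]
  refine ((contDiffAt_det hg).inv h0).mul (contDiffAt_det fun k l => ?_)
  by_cases hk : k = j
  · subst hk
    simpa using contDiffAt_const
  · simpa [Matrix.updateRow_ne hk] using hg k l

theorem contDiffAt_volDensity {d : ℕ} {g : (Fin d → ℝ) → Matrix (Fin d) (Fin d) ℝ}
    {x : Fin d → ℝ} (hg : ∀ i j, ContDiffAt ℝ ∞ (fun z => g z i j) x) (h0 : (g x).det ≠ 0) :
    ContDiffAt ℝ ∞ (volDensity g) x :=
  ((contDiffAt_det hg).abs h0).sqrt (abs_ne_zero.2 h0)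

theorem eq_zero_of_eta_eq_zero {n : ℕ} {v : Amb n} (h : ∀ w, eta n v w = 0) : v = 0 := by
  ext α
  have := h (Pi.single α 1)
  rw [eta_symm, eta_single] at this
  rcases mul_eq_zero.1 this with h' | h'
  · have := etaSign_mul_self α
    simp [h'] at this
  · exact h'

namespace Setting

variable {n : ℕ} (S : Setting n)

/-- The square `(ε H²)⁻¹` of `F / F²`; the square of the position vector of a point of `Σₙ` is its
opposite. -/
noncomputable def kap : ℝ := (S.ε * S.H ^ 2)⁻¹

theorem kap_ne : S.kap ≠ 0 := inv_ne_zero S.F_sq_ne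

theorem eta_origin_self : eta n S.origin S.origin = S.kap := by
  rw [eta_origin, f_origin, mul_one, kap]

namespace LocalParam

variable {S} (c : S.LocalParam) {z : Fin n → ℝ}

/-- The parametrisation, with values in the ambient space. -/
def emb (z : Fin n → ℝ) : Amb n := c.φ z

/-- The position vector in `P` of the points of the parametrisation. -/
noncomputable def pos (z : Fin n → ℝ) : Amb n := c.emb z - S.origin

theorem eventually_mem (hz : z ∈ c.U) : ∀ᶠ y in nhds z, y ∈ c.U := c.isOpen.mem_nhds hz

theorem contDiffAt_emb (hz : z ∈ c.U) : ContDiffAt ℝ ∞ c.emb z :=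
  c.smooth.contDiffAt (c.isOpen.mem_nhds hz)

theorem contDiffAt_coordVec (hz : z ∈ c.U) (i : Fin n) : ContDiffAt ℝ ∞ (c.coordVec i) z :=
  ((c.contDiffAt_emb hz).fderiv_right (m := ∞) (by simp)).clm_apply contDiffAt_const

theorem differentiableAt_emb (hz : z ∈ c.U) : DifferentiableAt ℝ c.emb z :=
  (c.contDiffAt_emb hz).differentiableAt (by simp)

theorem differentiableAt_coordVec (hz : z ∈ c.U) (i : Fin n) :
    DifferentiableAt ℝ (c.coordVec i) z :=
  (c.contDiffAt_coordVec hz i).differentiableAt (by simp)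

theorem f_emb (z : Fin n → ℝ) : S.f (c.emb z) = 1 := (c.φ z).2.2

theorem eta_emb (z : Fin n → ℝ) : eta n (c.emb z) (c.emb z) = 0 := (c.φ z).2.1

theorem eta_pos_self (z : Fin n → ℝ) : eta n (c.pos z) (c.pos z) = -S.kap :=
  S.eta_position (c.φ z)

theorem eta_origin_pos (z : Fin n → ℝ) : eta n S.origin (c.pos z) = 0 := by
  rw [eta_origin, pos, map_sub, f_emb, f_origin, sub_self, mul_zero]

theorem fderiv_emb (i : Fin n) : fderiv ℝ c.emb z (Pi.single i 1) = c.coordVec i z := rfl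

theorem eta_emb_coordVec (hz : z ∈ c.U) (i : Fin n) : eta n (c.emb z) (c.coordVec i z) = 0 := by
  have h := fderiv_eta (c.differentiableAt_emb hz) (c.differentiableAt_emb hz) (Pi.single i 1)
  simp only [eta_emb, fderiv_emb] at h
  rw [eta_symm (c.coordVec i z)] at h
  simp at h
  linarith

theorem eta_origin_coordVec (hz : z ∈ c.U) (i : Fin n) :
    eta n S.origin (c.coordVec i z) = 0 := by
  have h := fderiv_eta (differentiableAt_const S.origin) (c.differentiableAt_emb hz)
    (Pi.single i 1)
  simp only [eta_origin, f_emb, fderiv_emb] at h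
  simpa [eta_origin] using h

theorem f_coordVec (hz : z ∈ c.U) (i : Fin n) : S.f (c.coordVec i z) = 0 := by
  have h := c.eta_origin_coordVec hz i
  rw [eta_origin] at h
  exact (mul_eq_zero.1 h).resolve_left S.kap_ne

theorem eta_pos_coordVec (hz : z ∈ c.U) (i : Fin n) : eta n (c.pos z) (c.coordVec i z) = 0 := by
  rw [pos, map_sub, LinearMap.sub_apply, c.eta_emb_coordVec hz, c.eta_origin_coordVec hz, sub_zero]

theorem coordVec_mem (hz : z ∈ c.U) (i : Fin n) : c.coordVec i z ∈ S.tangent (c.φ z) :=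
  ⟨c.eta_emb_coordVec hz i, c.f_coordVec hz i⟩

theorem linearIndependent_coordVec (hz : z ∈ c.U) :
    LinearIndependent ℝ (fun i => c.coordVec i z) := by
  have h := (Pi.basisFun ℝ (Fin n)).linearIndependent.map'
    (fderiv ℝ c.emb z).toLinearMap (LinearMap.ker_eq_bot.2 (c.imm z hz))
  have h' : (fun i => c.coordVec i z) =
      (fderiv ℝ c.emb z).toLinearMap ∘ Pi.basisFun ℝ (Fin n) := by
    funext i
    simp [fderiv_emb]
  rw [h']
  exact h

/-- A vector orthogonal to the coordinate vectors, to the position vector and to the normal of `P`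
vanishes. -/
theorem eq_zero_of_orthogonal (hz : z ∈ c.U) {v : Amb n}
    (h₁ : ∀ i, eta n v (c.coordVec i z) = 0) (h₂ : eta n v (c.pos z) = 0)
    (h₃ : eta n v S.origin = 0) : v = 0 := by
  let b : Fin n ⊕ Fin 2 → Amb n := Sum.elim (fun i => c.coordVec i z) ![c.pos z, S.origin]
  have hb : LinearIndependent ℝ b := by
    rw [Fintype.linearIndependent_iff]
    intro a ha
    simp only [Fintype.sum_sum_type, b, Sum.elim_inl, Sum.elim_inr, Fin.sum_univ_two,
      Matrix.cons_val_zero, Matrix.cons_val_one] at ha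
    have ho : ∀ w, eta n w (∑ i, a (Sum.inl i) • c.coordVec i z) =
        ∑ i, a (Sum.inl i) * eta n w (c.coordVec i z) := by
      intro w; simp
    -- The position and origin vectors are orthogonal to each other and to all coordinate vectors,
    -- and have nonzero squares `-κ` and `κ`; pairing with either isolates its coefficient.
    have hp : a (Sum.inr 0) = 0 := by
      have := congrArg (eta n (c.pos z)) ha
      simp only [map_add, ho, c.eta_pos_coordVec hz, map_smul, eta_pos_self,
        eta_symm (c.pos z) S.origin, eta_origin_pos, map_zero] at this
      simpa [S.kap_ne] using this
    have hq : a (Sum.inr 1) = 0 := by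
      have := congrArg (eta n S.origin) ha
      simp only [map_add, ho, c.eta_origin_coordVec hz, map_smul, eta_origin_self,
        eta_origin_pos, map_zero] at this
      simpa [S.kap_ne] using this
    have hr := Fintype.linearIndependent_iff.1 (c.linearIndependent_coordVec hz)
      (fun i => a (Sum.inl i)) (by simpa [hp, hq] using ha)
    rintro (i | i)
    · exact hr i
    · fin_cases i
      · exact hp
      · exact hq
  have hspan : Submodule.span ℝ (Set.range b) = ⊤ :=
    hb.span_eq_top_of_card_eq_finrank' (by simp)
  refine eq_zero_of_eta_eq_zero fun w => ?_
  have hle : Submodule.span ℝ (Set.range b) ≤ LinearMap.ker (eta n v) := by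
    rw [Submodule.span_le]
    rintro _ ⟨i | i, rfl⟩
    · exact h₁ i
    · fin_cases i
      · exact h₂
      · exact h₃
  exact hle (hspan ▸ Submodule.mem_top)

theorem metric_apply (i j : Fin n) (z : Fin n → ℝ) :
    c.metric z i j = eta n (c.coordVec i z) (c.coordVec j z) := rfl

theorem metric_transpose (z : Fin n → ℝ) : (c.metric z).transpose = c.metric z := by
  ext i j
  rw [Matrix.transpose_apply, metric_apply, metric_apply, eta_symm]

theorem metric_inv_symm (i j : Fin n) (z : Fin n → ℝ) :
    (c.metric z)⁻¹ i j = (c.metric z)⁻¹ j i := by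
  conv_lhs => rw [← metric_transpose, ← Matrix.transpose_nonsing_inv, Matrix.transpose_apply]

/-- A kernel vector of the Gram matrix gives a tangent vector orthogonal to the tangent space. It is
also orthogonal to both normal directions, so it vanishes because `η` is nondegenerate. -/
theorem det_metric_ne (hz : z ∈ c.U) : (c.metric z).det ≠ 0 := by
  intro h
  obtain ⟨a, ha, h0⟩ := Matrix.exists_mulVec_eq_zero_iff.2 h
  have hv : ∑ j, a j • c.coordVec j z = 0 := by
    refine c.eq_zero_of_orthogonal hz (fun i => ?_) ?_ ?_
    · have := congrFun h0 i
      rw [eta_symm]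
      simpa [Matrix.mulVec, dotProduct, metric_apply, mul_comm] using this
    · simp [eta_symm _ (c.pos z), c.eta_pos_coordVec hz]
    · simp [eta_symm _ S.origin, c.eta_origin_coordVec hz]
  exact ha (funext (Fintype.linearIndependent_iff.1 (c.linearIndependent_coordVec hz) a hv))

theorem contDiffAt_metric (hz : z ∈ c.U) (i j : Fin n) :
    ContDiffAt ℝ ∞ (fun z => c.metric z i j) z :=
  contDiffAt_eta (c.contDiffAt_coordVec hz i) (c.contDiffAt_coordVec hz j)

/-- The Riemannian volume density in a parametrisation. -/
noncomputable def vol (z : Fin n → ℝ) : ℝ := volDensity c.metric z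

theorem vol_ne (hz : z ∈ c.U) : c.vol z ≠ 0 :=
  (Real.sqrt_pos.2 (abs_pos.2 (c.det_metric_ne hz))).ne'

theorem contDiffAt_vol (hz : z ∈ c.U) : ContDiffAt ℝ ∞ c.vol z :=
  contDiffAt_volDensity (c.contDiffAt_metric hz) (c.det_metric_ne hz)

/-- The coordinate vectors with raised index. -/
noncomputable def dualVec (i : Fin n) (z : Fin n → ℝ) : Amb n :=
  ∑ j, (c.metric z)⁻¹ i j • c.coordVec j z

theorem contDiffAt_dualVec (hz : z ∈ c.U) (i : Fin n) : ContDiffAt ℝ ∞ (c.dualVec i) z := by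
  unfold dualVec
  exact ContDiffAt.sum fun j _ => (contDiffAt_inv_apply (c.contDiffAt_metric hz)
    (c.det_metric_ne hz) i j).smul (c.contDiffAt_coordVec hz j)

theorem differentiableAt_vol (hz : z ∈ c.U) : DifferentiableAt ℝ c.vol z :=
  (c.contDiffAt_vol hz).differentiableAt (by simp)

theorem differentiableAt_dualVec (hz : z ∈ c.U) (i : Fin n) :
    DifferentiableAt ℝ (c.dualVec i) z :=
  (c.contDiffAt_dualVec hz i).differentiableAt (by simp)

theorem eta_dualVec_coordVec (hz : z ∈ c.U) (i k : Fin n) :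
    eta n (c.dualVec i z) (c.coordVec k z) = if i = k then 1 else 0 := by
  have h := congrFun (congrFun (Matrix.nonsing_inv_mul (c.metric z)
    (isUnit_iff_ne_zero.2 (c.det_metric_ne hz))) i) k
  rw [Matrix.mul_apply, Matrix.one_apply] at h
  rw [← h]
  simp [dualVec, metric_apply]

theorem eta_dualVec_pos (hz : z ∈ c.U) (i : Fin n) : eta n (c.dualVec i z) (c.pos z) = 0 := by
  simp [dualVec, eta_symm _ (c.pos z), c.eta_pos_coordVec hz]

theorem eta_dualVec_origin (hz : z ∈ c.U) (i : Fin n) : eta n (c.dualVec i z) S.origin = 0 := by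
  simp [dualVec, eta_symm _ S.origin, c.eta_origin_coordVec hz]

/-- Orthogonal decomposition of a vector. -/
theorem decomp (hz : z ∈ c.U) (v : Amb n) :
    v = ∑ k, eta n v (c.coordVec k z) • c.dualVec k z - (S.kap⁻¹ * eta n v (c.pos z)) • c.pos z +
      (S.kap⁻¹ * eta n v S.origin) • S.origin := by
  rw [← sub_eq_zero]
  have h0 := S.kap_ne
  refine c.eq_zero_of_orthogonal hz (fun i => ?_) ?_ ?_
  · simp [c.eta_dualVec_coordVec hz, c.eta_pos_coordVec hz, c.eta_origin_coordVec hz]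
  · simp [c.eta_dualVec_pos hz, c.eta_pos_self, c.eta_origin_pos]
    field_simp
    ring
  · simp [c.eta_dualVec_origin hz, eta_symm (c.pos z) S.origin, c.eta_origin_pos,
      S.eta_origin_self]
    field_simp
    ring

theorem sum_metric_smul_dualVec (hz : z ∈ c.U) (k : Fin n) :
    ∑ l, c.metric z k l • c.dualVec l z = c.coordVec k z := by
  conv_rhs => rw [c.decomp hz (c.coordVec k z)]
  simp [metric_apply, eta_symm _ (c.pos z), c.eta_pos_coordVec hz, eta_symm _ S.origin,
    c.eta_origin_coordVec hz]

/-- The trace of a bilinear form with respect to the ambient metric. -/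
theorem trace_eq (hz : z ∈ c.U) (T : Amb n →ₗ[ℝ] Amb n →ₗ[ℝ] ℝ) :
    ∑ α, etaSign α * T (Pi.single α 1) (Pi.single α 1) =
      ∑ i, T (c.coordVec i z) (c.dualVec i z) - S.kap⁻¹ * T (c.pos z) (c.pos z) +
        S.kap⁻¹ * T S.origin S.origin := by
  have hexp : ∀ v w : Amb n, T v w = ∑ α, v α * T (Pi.single α 1) w := by
    intro v w
    conv_lhs => rw [pi_eq_sum_univ' v]
    simp
  have h : ∀ α : Fin (n + 2), etaSign α * T (Pi.single α 1) (Pi.single α 1) =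
      ∑ i, c.coordVec i z α * T (Pi.single α 1) (c.dualVec i z) -
        S.kap⁻¹ * (c.pos z α * T (Pi.single α 1) (c.pos z)) +
        S.kap⁻¹ * (S.origin α * T (Pi.single α 1) S.origin) := by
    intro α
    have := etaSign_mul_self α
    have h1 := congrArg (T (Pi.single α 1)) (c.decomp hz (Pi.single α 1))
    -- Only the second slot is decomposed. Since `etaSign` squares to one, what remains in the first
    -- slot are plain coordinates, and the sum over `α` reassembles them into the frame vectors.
    simp only [map_add, map_sub, map_sum, map_smul, smul_eq_mul, eta_single] at h1
    have h2 : ∀ a b : ℝ, etaSign α * (etaSign α * a * b) = a * b := fun a b => by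
      linear_combination (a * b) * this
    have h3 : ∀ a b : ℝ, etaSign α * (S.kap⁻¹ * (etaSign α * a) * b) = S.kap⁻¹ * (a * b) :=
      fun a b => by linear_combination (S.kap⁻¹ * a * b) * this
    rw [h1, mul_add, mul_sub, Finset.mul_sum, h3, h3]
    simp only [h2]
  rw [Finset.sum_congr rfl fun α _ => h α, Finset.sum_add_distrib, Finset.sum_sub_distrib,
    Finset.sum_comm, ← Finset.mul_sum, ← Finset.mul_sum, ← hexp, ← hexp]
  simp only [← hexp]

end LocalParam

end Setting

/-! ### Derivatives of the frame, mean curvature, and the codifferentials on `Σₙ`. -/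

theorem pd_congr {d : ℕ} {u v : (Fin d → ℝ) → ℝ} {x : Fin d → ℝ} (h : u =ᶠ[nhds x] v)
    (i : Fin d) : pd i u x = pd i v x := by
  rw [pd, pd, h.fderiv_eq]

theorem pd_const_eq {d : ℕ} (a : ℝ) (i : Fin d) (x : Fin d → ℝ) : pd i (fun _ => a) x = 0 := by
  simp [pd]

namespace Setting

namespace LocalParam

variable {n : ℕ} {S : Setting n} (c : S.LocalParam) {z : Fin n → ℝ}

/-- Symmetry of the second derivative of the embedding. It stands in for the vanishing torsion of
the induced connection. -/
theorem fderiv_coordVec_comm (hz : z ∈ c.U) (i k : Fin n) :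
    fderiv ℝ (c.coordVec i) z (Pi.single k 1) = fderiv ℝ (c.coordVec k) z (Pi.single i 1) := by
  have hd : DifferentiableAt ℝ (fderiv ℝ c.emb) z :=
    ((c.contDiffAt_emb hz).fderiv_right (m := ∞) (by simp)).differentiableAt (by simp)
  have h : ∀ j k : Fin n, fderiv ℝ (c.coordVec j) z (Pi.single k 1) =
      fderiv ℝ (fderiv ℝ c.emb) z (Pi.single k 1) (Pi.single j 1) := by
    intro j k
    have := (hd.hasFDerivAt.clm_apply (hasFDerivAt_const (Pi.single j (1 : ℝ)) z)).fderiv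
    change fderiv ℝ (fun w => fderiv ℝ c.emb w (Pi.single j 1)) z _ = _
    rw [this]
    simp
  rw [h, h]
  exact ((c.contDiffAt_emb hz).isSymmSndFDerivAt (by
    rw [minSmoothness_of_isRCLikeNormedField]
    exact WithTop.coe_le_coe.2 (le_top (a := (2 : ℕ∞))))) _ _

/-- Differentiation of the scalar product of two vector fields that is constant along the
parametrisation. -/
theorem fderiv_eta_of_eventually {w₁ w₂ : (Fin n → ℝ) → Amb n} {r : (Fin n → ℝ) → ℝ}
    (hz : z ∈ c.U) (h₁ : DifferentiableAt ℝ w₁ z) (h₂ : DifferentiableAt ℝ w₂ z)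
    (h : ∀ y ∈ c.U, eta n (w₁ y) (w₂ y) = r y) (i : Fin n) :
    eta n (fderiv ℝ w₁ z (Pi.single i 1)) (w₂ z) =
      pd i r z - eta n (w₁ z) (fderiv ℝ w₂ z (Pi.single i 1)) := by
  have he : (fun y => eta n (w₁ y) (w₂ y)) =ᶠ[nhds z] r :=
    (c.eventually_mem hz).mono fun y hy => h y hy
  rw [pd, ← he.fderiv_eq, fderiv_eta h₁ h₂]
  ring

theorem differentiableAt_pos (hz : z ∈ c.U) : DifferentiableAt ℝ c.pos z :=
  (c.differentiableAt_emb hz).sub_const _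

theorem fderiv_pos (i : Fin n) : fderiv ℝ c.pos z (Pi.single i 1) = c.coordVec i z := by
  unfold pos
  rw [fderiv_sub_const]
  rfl

/-- The derivatives of the dual frame. -/
theorem fderiv_dualVec (hz : z ∈ c.U) (i l : Fin n) :
    fderiv ℝ (c.dualVec l) z (Pi.single i 1) =
      -∑ k, eta n (c.dualVec l z) (fderiv ℝ (c.coordVec k) z (Pi.single i 1)) • c.dualVec k z +
        (if l = i then S.kap⁻¹ else 0) • c.pos z := by
  have hE := c.differentiableAt_dualVec hz l
  conv_lhs => rw [c.decomp hz (fderiv ℝ (c.dualVec l) z (Pi.single i 1))]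
  rw [c.fderiv_eta_of_eventually hz hE (c.differentiableAt_pos hz)
    (fun y hy => c.eta_dualVec_pos hy l),
    c.fderiv_eta_of_eventually hz hE (differentiableAt_const S.origin)
    (fun y hy => c.eta_dualVec_origin hy l)]
  -- The tangential coefficients are minus the Christoffel symbols. The radial one is nonzero
  -- because the derivative of the position vector is a coordinate vector, dual to `dualVec`.
  simp only [c.fderiv_eta_of_eventually hz hE (c.differentiableAt_coordVec hz _)
    (fun y hy => c.eta_dualVec_coordVec hy l _), fderiv_pos, c.eta_dualVec_coordVec hz,
    pd_const_eq]
  split_ifs <;> simp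

/-- The density of a coordinate vector field with raised index. -/
noncomputable def densVec (i : Fin n) (z : Fin n → ℝ) : Amb n := c.vol z • c.dualVec i z

theorem differentiableAt_densVec (hz : z ∈ c.U) (i : Fin n) :
    DifferentiableAt ℝ (c.densVec i) z :=
  (c.differentiableAt_vol hz).smul (c.differentiableAt_dualVec hz i)

/-- The logarithmic derivative of the density is the contracted Christoffel symbol. The two terms in
the derivative of the metric contribute equally by symmetry, which absorbs the factor `1/2` of
`pd_volDensity`. -/
theorem pd_vol (hz : z ∈ c.U) (k : Fin n) :
    pd k c.vol z = c.vol z * ∑ i, eta n (c.dualVec i z)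
      (fderiv ℝ (c.coordVec i) z (Pi.single k 1)) := by
  have h := pd_volDensity (fun i j => (c.contDiffAt_metric hz i j).differentiableAt (by simp))
    (c.det_metric_ne hz) k
  change pd k c.vol z = c.vol z * _ at h
  rw [h]
  have h1 : ∀ i j, pd k (fun z => c.metric z i j) z =
      eta n (fderiv ℝ (c.coordVec i) z (Pi.single k 1)) (c.coordVec j z) +
      eta n (c.coordVec i z) (fderiv ℝ (c.coordVec j) z (Pi.single k 1)) := fun i j =>
    fderiv_eta (c.differentiableAt_coordVec hz i) (c.differentiableAt_coordVec hz j) _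
  simp only [h1, mul_add, Finset.sum_add_distrib]
  have h2 : ∑ i, ∑ j, (c.metric z)⁻¹ j i * eta n (fderiv ℝ (c.coordVec i) z (Pi.single k 1))
      (c.coordVec j z) =
      ∑ i, eta n (c.dualVec i z) (fderiv ℝ (c.coordVec i) z (Pi.single k 1)) := by
    simp only [dualVec, map_sum, map_smul, LinearMap.sum_apply, LinearMap.smul_apply, smul_eq_mul]
    refine Finset.sum_congr rfl fun i _ => Finset.sum_congr rfl fun j _ => ?_
    rw [metric_inv_symm, eta_symm]
  have h3 : ∑ i, ∑ j, (c.metric z)⁻¹ j i * eta n (c.coordVec i z)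
      (fderiv ℝ (c.coordVec j) z (Pi.single k 1)) =
      ∑ i, eta n (c.dualVec i z) (fderiv ℝ (c.coordVec i) z (Pi.single k 1)) := by
    simp only [dualVec, map_sum, map_smul, LinearMap.sum_apply, LinearMap.smul_apply, smul_eq_mul]
    rw [Finset.sum_comm]
  rw [h2, h3]
  ring

/-- The mean curvature vector of `Σₙ`. -/
theorem sum_fderiv_densVec (hz : z ∈ c.U) :
    ∑ i, fderiv ℝ (c.densVec i) z (Pi.single i 1) = (c.vol z * (n * S.kap⁻¹)) • c.pos z := by
  have hX := fun i => c.differentiableAt_densVec hz i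
  rw [c.decomp hz (∑ i, fderiv ℝ (c.densVec i) z (Pi.single i 1))]
  -- The tangential part vanishes: the term `i = k` yields the derivative of the density, which
  -- `pd_vol` cancels once the mixed partials have been exchanged.
  have h1 : ∀ k, eta n (∑ i, fderiv ℝ (c.densVec i) z (Pi.single i 1)) (c.coordVec k z) = 0 := by
    intro k
    rw [map_sum, LinearMap.sum_apply]
    have h : ∀ i, eta n (fderiv ℝ (c.densVec i) z (Pi.single i 1)) (c.coordVec k z) =
        (if i = k then pd i c.vol z else 0) - c.vol z * eta n (c.dualVec i z)
          (fderiv ℝ (c.coordVec i) z (Pi.single k 1)) := by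
      intro i
      rw [c.fderiv_eta_of_eventually (r := fun y => if i = k then c.vol y else 0) hz (hX i)
        (c.differentiableAt_coordVec hz k) (fun y hy => by
          rw [densVec, map_smul, LinearMap.smul_apply, c.eta_dualVec_coordVec hy]; simp),
        c.fderiv_coordVec_comm hz k i]
      split_ifs <;> simp [densVec, pd]
    simp only [h, Finset.sum_sub_distrib, ← Finset.mul_sum]
    simp [c.pd_vol hz]
  -- The position vector differentiates to the coordinate vectors, so each of the `n` indices
  -- contributes minus the density.
  have h2 : eta n (∑ i, fderiv ℝ (c.densVec i) z (Pi.single i 1)) (c.pos z) = -(n * c.vol z) := by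
    rw [map_sum, LinearMap.sum_apply]
    have h : ∀ i, eta n (fderiv ℝ (c.densVec i) z (Pi.single i 1)) (c.pos z) = -c.vol z := by
      intro i
      rw [c.fderiv_eta_of_eventually (r := fun y => 0) hz (hX i)
        (c.differentiableAt_pos hz) (fun y hy => by
          rw [densVec, map_smul, LinearMap.smul_apply, c.eta_dualVec_pos hy, smul_zero]),
        fderiv_pos, densVec, map_smul, LinearMap.smul_apply, c.eta_dualVec_coordVec hz,
        pd_const_eq]
      simp
    simp [h]
  have h3 : eta n (∑ i, fderiv ℝ (c.densVec i) z (Pi.single i 1)) S.origin = 0 := by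
    rw [map_sum, LinearMap.sum_apply]
    refine Finset.sum_eq_zero fun i _ => ?_
    rw [c.fderiv_eta_of_eventually (r := fun y => 0) hz (hX i)
        (differentiableAt_const S.origin) (fun y hy => by
          rw [densVec, map_smul, LinearMap.smul_apply, c.eta_dualVec_origin hy, smul_zero]),
        pd_const_eq]
    simp
  rw [h2, h3]
  simp only [h1, zero_smul, Finset.sum_const_zero, mul_zero, add_zero, zero_sub, ← neg_smul]
  congr 1
  ring

/-- The codifferential, in a parametrisation, of the restriction of an ambient one-form. -/
theorem codiff1_metric (hz : z ∈ c.U) {A : Amb n → Amb n →L[ℝ] ℝ}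
    (hA : DifferentiableAt ℝ A (c.emb z)) {a : Fin n → (Fin n → ℝ) → ℝ}
    (ha : ∀ y ∈ c.U, ∀ j, a j y = A (c.emb y) (c.coordVec j y)) :
    codiff1 c.metric a z = -(∑ i, fderiv ℝ A (c.emb z) (c.coordVec i z) (c.dualVec i z) +
      n * S.kap⁻¹ * A (c.emb z) (c.pos z)) := by
  have h : ∀ i, pd i (fun y => volDensity c.metric y * ∑ j, (c.metric y)⁻¹ i j * a j y) z =
      c.vol z * fderiv ℝ A (c.emb z) (c.coordVec i z) (c.dualVec i z) +
      A (c.emb z) (fderiv ℝ (c.densVec i) z (Pi.single i 1)) := by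
    intro i
    -- Raising the index and multiplying by the density amounts to evaluating `A` on `densVec`, so
    -- the product rule separates the derivative of `A` from that of the frame.
    rw [pd_congr (v := fun y => A (c.emb y) (c.densVec i y))]
    · have hAe := hA.hasFDerivAt.comp z (c.differentiableAt_emb hz).hasFDerivAt
      have := (hAe.clm_apply (c.differentiableAt_densVec hz i).hasFDerivAt).fderiv
      rw [pd]
      simp only [Function.comp_apply] at this
      rw [this]
      simp [fderiv_emb, densVec, add_comm]
    · filter_upwards [c.eventually_mem hz] with y hy
      simp only [densVec, dualVec, map_smul, map_sum, smul_eq_mul, ha y hy, vol]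
  rw [codiff1]
  simp only [h, Finset.sum_add_distrib, ← Finset.mul_sum, ← map_sum, c.sum_fderiv_densVec hz]
  have := c.vol_ne hz
  change -((c.vol z)⁻¹ * _) = _
  rw [map_smul, smul_eq_mul]
  field_simp

/-- The codifferential, in a parametrisation, of the restriction of an ambient two-form. -/
theorem codiff2_metric (hz : z ∈ c.U) {B : Amb n → Amb n →L[ℝ] Amb n →L[ℝ] ℝ}
    (hB : DifferentiableAt ℝ B (c.emb z)) (hanti : ∀ v w, B (c.emb z) v w = -B (c.emb z) w v)
    {F : Fin n → Fin n → (Fin n → ℝ) → ℝ}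
    (hF : ∀ y ∈ c.U, ∀ j m, F j m y = B (c.emb y) (c.coordVec j y) (c.coordVec m y))
    (k : Fin n) :
    codiff2 c.metric F k z =
      -(∑ i, fderiv ℝ B (c.emb z) (c.coordVec i z) (c.dualVec i z) (c.coordVec k z) +
        (n - 1) * S.kap⁻¹ * B (c.emb z) (c.pos z) (c.coordVec k z)) := by
  have h : ∀ i l, pd i (fun y => volDensity c.metric y *
      ∑ j, ∑ m, (c.metric y)⁻¹ i j * (c.metric y)⁻¹ l m * F j m y) z =
      c.vol z * fderiv ℝ B (c.emb z) (c.coordVec i z) (c.dualVec i z) (c.dualVec l z) +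
      B (c.emb z) (fderiv ℝ (c.densVec i) z (Pi.single i 1)) (c.dualVec l z) +
      c.vol z * B (c.emb z) (c.dualVec i z) (fderiv ℝ (c.dualVec l) z (Pi.single i 1)) := by
    intro i l
    rw [pd_congr (v := fun y => B (c.emb y) (c.densVec i y) (c.dualVec l y))]
    · have hBe := HasFDerivAt.comp (g := B) z hB.hasFDerivAt (c.differentiableAt_emb hz).hasFDerivAt
      have := ((hBe.clm_apply (c.differentiableAt_densVec hz i).hasFDerivAt).clm_apply
        (c.differentiableAt_dualVec hz l).hasFDerivAt).fderiv
      rw [pd]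
      simp only [Function.comp_apply] at this
      rw [this]
      simp [fderiv_emb, densVec]
      ring
    · filter_upwards [c.eventually_mem hz] with y hy
      simp only [densVec, dualVec, map_smul, map_sum, smul_eq_mul, hF y hy, vol,
        sum_apply, smul_apply, Finset.mul_sum]
      rw [Finset.sum_comm]
      refine Finset.sum_congr rfl fun j _ => Finset.sum_congr rfl fun m _ => by ring
  have hE : ∀ l, ∑ i, B (c.emb z) (c.dualVec i z)
      (fderiv ℝ (c.dualVec l) z (Pi.single i 1)) =
      -(S.kap⁻¹ * B (c.emb z) (c.pos z) (c.dualVec l z)) := by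
    intro l
    simp only [c.fderiv_dualVec hz, map_add, map_neg, map_sum, map_smul, smul_eq_mul,
      Finset.sum_add_distrib]
    -- Christoffel symbols are symmetric in `i`, `k` and the two-form is antisymmetric, so only the
    -- radial part of the derivative of `dualVec` survives.
    have h0 : ∑ i, ∑ k, eta n (c.dualVec l z) (fderiv ℝ (c.coordVec k) z (Pi.single i 1)) *
        B (c.emb z) (c.dualVec i z) (c.dualVec k z) = 0 := by
      have h1 : ∑ i, ∑ k, eta n (c.dualVec l z) (fderiv ℝ (c.coordVec k) z (Pi.single i 1)) *
        B (c.emb z) (c.dualVec i z) (c.dualVec k z) =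
        -∑ i, ∑ k, eta n (c.dualVec l z) (fderiv ℝ (c.coordVec k) z (Pi.single i 1)) *
        B (c.emb z) (c.dualVec i z) (c.dualVec k z) := by
        conv_lhs => rw [Finset.sum_comm]
        simp only [← Finset.sum_neg_distrib]
        refine Finset.sum_congr rfl fun i _ => Finset.sum_congr rfl fun k _ => ?_
        rw [hanti, c.fderiv_coordVec_comm hz]
        ring
      linarith
    rw [Finset.sum_neg_distrib, h0, hanti (c.pos z)]
    simp
  have hin : ∀ l, (volDensity c.metric z)⁻¹ * ∑ i, pd i (fun y => volDensity c.metric y *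
      ∑ j, ∑ m, (c.metric y)⁻¹ i j * (c.metric y)⁻¹ l m * F j m y) z =
      (∑ i, fderiv ℝ B (c.emb z) (c.coordVec i z) (c.dualVec i z) +
        ((n - 1) * S.kap⁻¹) • B (c.emb z) (c.pos z)) (c.dualVec l z) := by
    intro l
    have := c.vol_ne hz
    change (c.vol z)⁻¹ * _ = _
    simp only [h, Finset.sum_add_distrib, ← Finset.mul_sum, hE]
    have hN : ∑ i, B (c.emb z) (fderiv ℝ (c.densVec i) z (Pi.single i 1)) (c.dualVec l z) =
        c.vol z * (n * S.kap⁻¹) * B (c.emb z) (c.pos z) (c.dualVec l z) := by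
      rw [← sum_apply, ← map_sum, c.sum_fderiv_densVec hz]
      simp
    rw [hN]
    simp
    field_simp
    ring
  rw [codiff2]
  simp only [hin, ← smul_eq_mul (a := c.metric z k _), ← map_smul, ← map_sum,
    c.sum_metric_smul_dualVec hz]
  simp

end LocalParam

end Setting

/-! ### The flat operators -/

section Flat

variable {n : ℕ} {y : Amb n}

theorem codiff1_etaMat {A : Amb n → Amb n →L[ℝ] ℝ} (hA : DifferentiableAt ℝ A y)
    {a : Fin (n + 2) → Amb n → ℝ} (ha : ∀ᶠ z in nhds y, ∀ β, a β z = A z (Pi.single β 1)) :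
    codiff1 (fun _ => etaMat n) a y =
      -∑ α, etaSign α * fderiv ℝ A y (Pi.single α 1) (Pi.single α 1) := by
  simp only [codiff1, volDensity_etaMat, etaMat_inv, inv_one, one_mul]
  congr 1
  refine Finset.sum_congr rfl fun α _ => ?_
  have h := ((hA.hasFDerivAt.clm_apply
    (hasFDerivAt_const (Pi.single α (1 : ℝ)) y)).const_mul (etaSign α)).fderiv
  rw [pd_congr (v := fun z => etaSign α * A z (Pi.single α 1)), pd, h]
  · simp
  · filter_upwards [ha] with z hz
    simp [etaMat_eq, hz, Matrix.diagonal_apply]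

theorem codiff2_etaMat {B : Amb n → Amb n →L[ℝ] Amb n →L[ℝ] ℝ} (hB : DifferentiableAt ℝ B y)
    {F : Fin (n + 2) → Fin (n + 2) → Amb n → ℝ}
    (hF : ∀ᶠ z in nhds y, ∀ β γ, F β γ z = B z (Pi.single β 1) (Pi.single γ 1))
    (k : Fin (n + 2)) :
    codiff2 (fun _ => etaMat n) F k y =
      -∑ α, etaSign α * fderiv ℝ B y (Pi.single α 1) (Pi.single α 1) (Pi.single k 1) := by
  have hpd : ∀ i l, pd i (fun z => ∑ j, ∑ m, etaMat n i j * etaMat n l m * F j m z) y =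
      etaSign i * etaSign l * fderiv ℝ B y (Pi.single i 1) (Pi.single i 1) (Pi.single l 1) := by
    intro i l
    have h := (((hB.hasFDerivAt.clm_apply (hasFDerivAt_const (Pi.single i (1 : ℝ)) y)).clm_apply
      (hasFDerivAt_const (Pi.single l (1 : ℝ)) y)).const_mul (etaSign i * etaSign l)).fderiv
    rw [pd_congr (v := fun z => etaSign i * etaSign l * B z (Pi.single i 1) (Pi.single l 1)),
      pd, h]
    · simp
    · filter_upwards [hF] with z hz
      simp [etaMat_eq, hz, Matrix.diagonal_apply]
  simp only [codiff2, volDensity_etaMat, etaMat_inv, inv_one, one_mul, hpd]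
  congr 1
  rw [Finset.sum_eq_single k]
  · rw [etaMat_eq, Matrix.diagonal_apply_eq, Finset.mul_sum]
    refine Finset.sum_congr rfl fun α _ => ?_
    linear_combination (etaSign α * fderiv ℝ B y (Pi.single α 1) (Pi.single α 1)
      (Pi.single k 1)) * etaSign_mul_self k
  · intro l _ hl
    rw [etaMat_eq, Matrix.diagonal_apply_ne _ hl.symm, zero_mul]
  · simp

/-- The exterior derivative of an ambient one-form. -/
noncomputable def curl (A : Amb n → Amb n →L[ℝ] ℝ) (y : Amb n) : Amb n →L[ℝ] Amb n →L[ℝ] ℝ :=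
  fderiv ℝ A y - (fderiv ℝ A y).flip

theorem curl_apply (A : Amb n → Amb n →L[ℝ] ℝ) (y v w : Amb n) :
    curl A y v w = fderiv ℝ A y v w - fderiv ℝ A y w v := rfl

theorem contDiffAt_curl {A : Amb n → Amb n →L[ℝ] ℝ} (hA : ContDiffAt ℝ ∞ A y) :
    ContDiffAt ℝ ∞ (curl A) y := by
  have h := hA.fderiv_right (m := ∞) (by simp)
  have hflip : ContDiff ℝ ∞ fun L : Amb n →L[ℝ] Amb n →L[ℝ] ℝ => L.flip :=
    contDiff_clm_apply_iff.2 fun v => contDiff_clm_apply_iff.2 fun w =>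
      (contDiff_id.clm_apply contDiff_const).clm_apply contDiff_const
  exact h.sub (hflip.contDiffAt.comp y h)

/-- A one-form, with values in the continuous dual. -/
noncomputable def toCLM (a : Amb n → Module.Dual ℝ (Amb n)) (y : Amb n) : Amb n →L[ℝ] ℝ :=
  LinearMap.toContinuousLinearMap (a y)

theorem toCLM_apply (a : Amb n → Module.Dual ℝ (Amb n)) (y v : Amb n) : toCLM a y v = a y v := rfl

theorem contDiffOn_toCLM {a : Amb n → Module.Dual ℝ (Amb n)} {N : Set (Amb n)}
    (ha : SmoothFormOn a N) : ContDiffOn ℝ ∞ (toCLM a) N :=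
  contDiffOn_clm_apply.2 ha

/-- The parts `dδ` and `δd` are kept apart because each is compared separately with its counterpart
on `Σₙ`. Differentiability of the codifferential is recorded so that its differential can be
restricted by the chain rule. -/
theorem flatBox1_eq {a : Amb n → Module.Dual ℝ (Amb n)} (ha : ContDiffAt ℝ ∞ (toCLM a) y)
    (v : Amb n) :
    DifferentiableAt ℝ (codiff1 (fun _ => etaMat n) fun β z => a z (Pi.single β 1)) y ∧
    flatBox1 a y v = -fderiv ℝ (codiff1 (fun _ => etaMat n) fun β z => a z (Pi.single β 1)) y v +
      ∑ α, etaSign α * fderiv ℝ (curl (toCLM a)) y (Pi.single α 1) (Pi.single α 1) v := by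
  have hev : ∀ᶠ z in nhds y, DifferentiableAt ℝ (toCLM a) z :=
    ((ha.of_le (m := 1) (by simp)).eventually (by simp)).mono
      fun z hz => hz.differentiableAt (by simp)
  have hd : DifferentiableAt ℝ (codiff1 (fun _ => etaMat n) fun β z => a z (Pi.single β 1)) y := by
    have h : (codiff1 (fun _ => etaMat n) fun β z => a z (Pi.single β 1)) =ᶠ[nhds y]
        fun z => -∑ α, etaSign α * fderiv ℝ (toCLM a) z (Pi.single α 1) (Pi.single α 1) :=
      hev.mono fun z hz => codiff1_etaMat hz (Filter.Eventually.of_forall fun _ _ => rfl)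
    rw [h.differentiableAt_iff]
    have h1 : DifferentiableAt ℝ (fderiv ℝ (toCLM a)) y :=
      (ha.fderiv_right (m := ∞) (by simp)).differentiableAt (by simp)
    fun_prop
  refine ⟨hd, ?_⟩
  have hF : ∀ᶠ z in nhds y, ∀ β γ, extDer1 (fun β z => a z (Pi.single β 1)) β γ z =
      curl (toCLM a) z (Pi.single β 1) (Pi.single γ 1) := by
    filter_upwards [hev] with z hz β γ
    have h : ∀ β γ, pd β (fun z => a z (Pi.single γ 1)) z =
        fderiv ℝ (toCLM a) z (Pi.single β 1) (Pi.single γ 1) := by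
      intro β γ
      have := (hz.hasFDerivAt.clm_apply (hasFDerivAt_const (Pi.single γ (1 : ℝ)) z)).fderiv
      simp only [toCLM_apply] at this
      rw [pd, this]
      simp
    rw [extDer1, h, h, curl_apply]
  have hexp : ∀ T : Amb n →L[ℝ] ℝ, T v = ∑ α, v α * T (Pi.single α 1) := by
    intro T
    conv_lhs => rw [pi_eq_sum_univ' v]
    simp
  simp only [flatBox1, box1, extDer0, codiff2_etaMat ((contDiffAt_curl ha).differentiableAt
    (by simp)) hF]
  have h2 : ∑ α, etaSign α * fderiv ℝ (curl (toCLM a)) y (Pi.single α 1) (Pi.single α 1) v =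
      (∑ α, etaSign α • fderiv ℝ (curl (toCLM a)) y (Pi.single α 1) (Pi.single α 1)) v := by
    simp
  rw [h2, hexp (fderiv ℝ _ y), hexp (∑ α, _), ← Finset.sum_neg_distrib, ← Finset.sum_add_distrib]
  refine Finset.sum_congr rfl fun α _ => ?_
  simp [pd]
  ring

end Flat

/-! ### Homogeneous fields: the flat and intrinsic operators compared on `Σₙ`. -/

namespace Setting

variable {n : ℕ} {S : Setting n}

theorem projLin_apply (y : Amb n) : S.projLin y = y - S.f y • S.origin := rfl

theorem proj_sub_origin (y : Amb n) : S.proj y - S.origin = S.projLin y := by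
  rw [proj, projLin_apply, sub_smul, one_smul]
  abel

theorem projLin_origin : S.projLin S.origin = 0 := by
  rw [projLin_apply, f_origin, one_smul, sub_self]

theorem projLin_projLin (y : Amb n) : S.projLin (S.projLin y) = S.projLin y := by
  conv_lhs => rw [projLin_apply y, map_sub, map_smul, projLin_origin, smul_zero, sub_zero]

theorem LocalParam.pos_eq (c : S.LocalParam) (z : Fin n → ℝ) : c.pos z = S.projLin (c.emb z) := by
  rw [projLin_apply, c.f_emb, one_smul, pos]

variable (S) in
/-- The projection as a continuous linear map. -/
noncomputable def projL : Amb n →L[ℝ] Amb n := LinearMap.toContinuousLinearMap S.projLin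

theorem projL_apply (y : Amb n) : S.projL y = S.projLin y := rfl

/-- Functions on an open set that are invariant under translations along the normal of `P` and
homogeneous of degree `r` under dilations of `P`, in infinitesimal form. -/
structure ScalarHomogeneous (S : Setting n) (r : ℝ) (W : Set (Amb n)) (u : Amb n → ℝ) : Prop where
  smooth : ContDiffOn ℝ ∞ u W
  euler : ∀ y ∈ W, fderiv ℝ u y (S.projLin y) = r * u y
  invariant : ∀ y ∈ W, fderiv ℝ u y S.origin = 0

/-- One-forms on an open set that are pulled back from `P`, vanish on the radial direction, and are
homogeneous of degree `r`, in infinitesimal form. -/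
structure FormHomogeneous (S : Setting n) (r : ℝ) (W : Set (Amb n))
    (a : Amb n → Module.Dual ℝ (Amb n)) : Prop where
  smooth : SmoothFormOn a W
  euler : ∀ y ∈ W, ∀ v, fderiv ℝ (toCLM a) y (S.projLin y) v = (r - 1) * a y v
  invariant : ∀ y ∈ W, ∀ v, fderiv ℝ (toCLM a) y S.origin v = 0
  radial : ∀ y ∈ W, a y (S.projLin y) = 0
  normal : ∀ y ∈ W, a y S.origin = 0

theorem fderiv_clm_projLin {G : Type*} [NormedAddCommGroup G] [NormedSpace ℝ G]
    {A : Amb n → Amb n →L[ℝ] G} {y : Amb n}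
    (hA : DifferentiableAt ℝ A y) (v : Amb n) :
    fderiv ℝ (fun y => A y (S.projLin y)) y v =
      fderiv ℝ A y v (S.projLin y) + A y (S.projLin v) := by
  have := (hA.hasFDerivAt.clm_apply S.projL.hasFDerivAt).fderiv
  simp only [projL_apply] at this
  rw [this]
  simp [add_comm, projL_apply]

theorem fderiv_clm_const {G : Type*} [NormedAddCommGroup G] [NormedSpace ℝ G]
    {A : Amb n → Amb n →L[ℝ] G} {y : Amb n}
    (hA : DifferentiableAt ℝ A y) (v w : Amb n) :
    fderiv ℝ (fun y => A y w) y v = fderiv ℝ A y v w := by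
  rw [(hA.hasFDerivAt.clm_apply (hasFDerivAt_const w y)).fderiv]
  simp

/-- The flat Laplacian of a homogeneous function, on `Σₙ`. -/
theorem ScalarHomogeneous.flatBox0_eq {r : ℝ} {W : Set (Amb n)} {u : Amb n → ℝ}
    (hu : S.ScalarHomogeneous r W u) (hW : IsOpen W) (hSW : S.space ⊆ W) (c : S.LocalParam)
    {z : Fin n → ℝ} (hz : z ∈ c.U) {b : (Fin n → ℝ) → ℝ} (hb : ∀ y ∈ c.U, b y = u (c.emb y)) :
    flatBox0 u (c.emb z) = box0 c.metric b z - S.kap⁻¹ * (r * (r + (n - 1))) * u (c.emb z) := by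
  have hmem : ∀ y, c.emb y ∈ W := fun y => hSW (c.φ y).2
  have hnhds : W ∈ nhds (c.emb z) := hW.mem_nhds (hmem z)
  have hCD : ∀ y ∈ W, ContDiffAt ℝ ∞ u y := fun y hy => hu.smooth.contDiffAt (hW.mem_nhds hy)
  have hd : ∀ y ∈ W, DifferentiableAt ℝ u y := fun y hy => (hCD y hy).differentiableAt (by simp)
  have hA : DifferentiableAt ℝ (fderiv ℝ u) (c.emb z) :=
    ((hCD _ (hmem z)).fderiv_right (m := ∞) (by simp)).differentiableAt (by simp)
  have h1 : fderiv ℝ (fderiv ℝ u) (c.emb z) (c.pos z) (c.pos z) = r * (r - 1) * u (c.emb z) := by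
    -- Differentiating Euler's relation along `x` gives `D²u(x,x) + Du(x) = r Du(x)`, hence the
    -- factor `r (r - 1)`.
    have he : (fun y => fderiv ℝ u y (S.projLin y)) =ᶠ[nhds (c.emb z)] fun y => r * u y :=
      Filter.eventually_of_mem hnhds hu.euler
    have h2 := congrArg (fun L : Amb n →L[ℝ] ℝ => L (c.pos z)) he.fderiv_eq
    simp only [fderiv_clm_projLin hA, fderiv_const_mul (hd _ (hmem z)), smul_apply, smul_eq_mul,
      c.pos_eq, projLin_projLin, hu.euler _ (hmem z)] at h2
    rw [c.pos_eq]
    linear_combination h2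
  have h3 : fderiv ℝ (fderiv ℝ u) (c.emb z) S.origin S.origin = 0 := by
    have he : (fun y => fderiv ℝ u y S.origin) =ᶠ[nhds (c.emb z)] fun y => 0 :=
      Filter.eventually_of_mem hnhds hu.invariant
    rw [← fderiv_clm_const hA, he.fderiv_eq]
    simp
  have h4 : ∀ y ∈ c.U, ∀ j, extDer0 b j y = fderiv ℝ u (c.emb y) (c.coordVec j y) := by
    intro y hy j
    have he : b =ᶠ[nhds y] fun y => u (c.emb y) :=
      (c.eventually_mem hy).mono fun y hy => hb y hy
    rw [extDer0, pd_congr he, pd]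
    have := ((hd _ (hmem y)).hasFDerivAt.comp y (c.differentiableAt_emb hy).hasFDerivAt).fderiv
    change fderiv ℝ (u ∘ c.emb) y _ = _
    rw [this]
    rfl
  rw [flatBox0, box0, box0, codiff1_etaMat (a := extDer0 u) hA (Filter.Eventually.of_forall fun _ _ => rfl),
    c.codiff1_metric hz hA h4]
  have h5 : fderiv ℝ u (c.emb z) (c.pos z) = r * u (c.emb z) := by
    rw [c.pos_eq, hu.euler _ (hmem z)]
  have htr := c.trace_eq hz (LinearMap.mk₂ ℝ (fun v w => fderiv ℝ (fderiv ℝ u) (c.emb z) v w)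
    (by simp) (by simp) (by simp) (by simp))
  simp only [LinearMap.mk₂_apply, h1, h3] at htr
  rw [htr, h5]
  ring

/-- The flat Laplace-de Rham operator on a homogeneous one-form, on `Σₙ`. -/
theorem FormHomogeneous.flatBox1_eq {r : ℝ} {W : Set (Amb n)} {a : Amb n → Module.Dual ℝ (Amb n)}
    (ha : S.FormHomogeneous r W a) (hW : IsOpen W) (hSW : S.space ⊆ W) (c : S.LocalParam)
    {z : Fin n → ℝ} (hz : z ∈ c.U) {b : Fin n → (Fin n → ℝ) → ℝ}
    (hb : ∀ y ∈ c.U, ∀ j, b j y = a (c.emb y) (c.coordVec j y)) (k : Fin n) :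
    flatBox1 a (c.emb z) (c.coordVec k z) =
      box1 c.metric b k z - S.kap⁻¹ * (r * (r + (n - 3))) * a (c.emb z) (c.coordVec k z) := by
  set A := toCLM a with hAdef
  have heul : ∀ y ∈ W, ∀ v, fderiv ℝ A y (S.projLin y) v = (r - 1) * A y v := ha.euler
  have hinv : ∀ y ∈ W, ∀ v, fderiv ℝ A y S.origin v = 0 := ha.invariant
  have hmem : ∀ y, c.emb y ∈ W := fun y => hSW (c.φ y).2
  have hnhds : ∀ y ∈ W, W ∈ nhds y := fun y hy => hW.mem_nhds hy
  have hCD : ∀ y ∈ W, ContDiffAt ℝ ∞ A y := fun y hy =>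
    (contDiffOn_toCLM ha.smooth).contDiffAt (hW.mem_nhds hy)
  have hd : ∀ y ∈ W, DifferentiableAt ℝ A y := fun y hy => (hCD y hy).differentiableAt (by simp)
  have hB : DifferentiableAt ℝ (curl A) (c.emb z) :=
    (contDiffAt_curl (hCD _ (hmem z))).differentiableAt (by simp)
  -- the contractions of the exterior derivative
  have hBx : ∀ y ∈ W, ∀ v, curl A y (S.projLin y) v = r * A y v := by
    intro y hy v
    -- Differentiating `a(x) = 0` along `v` gives `(D_v a)(x) = -a(v)`, since `a` kills the origin
    -- vector. Subtracting this from `(D_x a)(v) = (r - 1) a(v)` gives `r a(v)`.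
    have he : (fun y => A y (S.projLin y)) =ᶠ[nhds y] fun y => 0 :=
      Filter.eventually_of_mem (hnhds y hy) ha.radial
    have h2 := congrArg (fun L : Amb n →L[ℝ] ℝ => L v) he.fderiv_eq
    simp only [fderiv_clm_projLin (hd y hy), fderiv_fun_const, Pi.zero_apply, zero_apply,
      projLin_apply v, map_sub, map_smul, smul_eq_mul] at h2
    have h3 : A y S.origin = 0 := ha.normal y hy
    rw [curl_apply, heul y hy]
    rw [h3] at h2
    linear_combination -h2
  have hBo : ∀ y ∈ W, ∀ v, curl A y S.origin v = 0 := by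
    intro y hy v
    have he : (fun y => A y S.origin) =ᶠ[nhds y] fun y => 0 :=
      Filter.eventually_of_mem (hnhds y hy) ha.normal
    have h2 := congrArg (fun L : Amb n →L[ℝ] ℝ => L v) he.fderiv_eq
    simp only [fderiv_clm_const (hd y hy), fderiv_fun_const, Pi.zero_apply, zero_apply] at h2
    rw [curl_apply, hinv y hy, h2, sub_zero]
  have hDBx : ∀ v, fderiv ℝ (curl A) (c.emb z) (c.pos z) (c.pos z) v =
      r * (r - 2) * A (c.emb z) v := by
    intro v
    -- Differentiating `ι_x da = r a` along `x` gives `r (r - 1) a` on the right, of which one `r a`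
    -- comes from differentiating `x` itself; the factor is `r (r - 2)`.
    have he : (fun y => curl A y (S.projLin y) ) =ᶠ[nhds (c.emb z)] fun y => r • A y :=
      Filter.eventually_of_mem (hnhds _ (hmem z)) fun y hy => by
        ext v
        exact hBx y hy v
    have h2 := congrArg (fun L : Amb n →L[ℝ] Amb n →L[ℝ] ℝ => L (c.pos z) v) he.fderiv_eq
    simp only [fderiv_clm_projLin hB, fderiv_fun_const_smul (hd _ (hmem z)), smul_apply,
      smul_eq_mul, add_apply, c.pos_eq, projLin_projLin, hBx _ (hmem z),
      heul _ (hmem z)] at h2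
    rw [c.pos_eq]
    linear_combination h2
  have hDBo : ∀ v, fderiv ℝ (curl A) (c.emb z) S.origin S.origin v = 0 := by
    intro v
    have he : (fun y => curl A y S.origin) =ᶠ[nhds (c.emb z)] fun y => 0 :=
      Filter.eventually_of_mem (hnhds _ (hmem z)) fun y hy => by
        ext v
        exact hBo y hy v
    have h2 := congrArg (fun L : Amb n →L[ℝ] Amb n →L[ℝ] ℝ => L S.origin v) he.fderiv_eq
    simpa only [fderiv_clm_const hB, fderiv_fun_const, Pi.zero_apply, zero_apply] using h2
  -- the codifferentials of the one-form agree along the parametrisation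
  obtain ⟨hdiv, hflat⟩ := AdSExt.flatBox1_eq (hCD _ (hmem z)) (c.coordVec k z)
  have hcod : ∀ y ∈ c.U, codiff1 c.metric b y =
      codiff1 (fun _ => etaMat n) (fun β z => a z (Pi.single β 1)) (c.emb y) := by
    intro y hy
    rw [c.codiff1_metric hy (hd _ (hmem y)) (fun y hy j => hb y hy j),
      codiff1_etaMat (a := fun β z => a z (Pi.single β 1)) (hd _ (hmem y))
        (Filter.Eventually.of_forall fun _ _ => rfl)]
    have htr := c.trace_eq hy (LinearMap.mk₂ ℝ (fun v w => fderiv ℝ A (c.emb y) v w)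
      (by simp) (by simp) (by simp) (by simp))
    have h0 : A (c.emb y) (c.pos y) = 0 := by
      rw [c.pos_eq]
      exact ha.radial _ (hmem y)
    have h1 : fderiv ℝ A (c.emb y) (c.pos y) (c.pos y) = 0 := by
      have := heul _ (hmem y) (c.pos y)
      rw [← c.pos_eq, h0, mul_zero] at this
      exact this
    simp only [LinearMap.mk₂_apply, h1, hinv _ (hmem y)] at htr
    rw [htr, h0]
    ring
  have hdcod : pd k (codiff1 c.metric b) z = fderiv ℝ (codiff1 (fun _ => etaMat n)
      fun β z => a z (Pi.single β 1)) (c.emb z) (c.coordVec k z) := by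
    rw [pd_congr ((c.eventually_mem hz).mono fun y hy => hcod y hy), pd]
    have := (hdiv.hasFDerivAt.comp z (c.differentiableAt_emb hz).hasFDerivAt).fderiv
    simp only [Function.comp_def] at this
    rw [this]
    rfl
  -- the exterior derivatives
  have hF : ∀ y ∈ c.U, ∀ j m, extDer1 b j m y =
      curl A (c.emb y) (c.coordVec j y) (c.coordVec m y) := by
    intro y hy j m
    have h : ∀ j m, pd j (b m) y = fderiv ℝ A (c.emb y) (c.coordVec j y) (c.coordVec m y) +
        A (c.emb y) (fderiv ℝ (c.coordVec m) y (Pi.single j 1)) := by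
      intro j m
      rw [pd_congr ((c.eventually_mem hy).mono fun y hy => hb y hy m), pd]
      have := (((hd _ (hmem y)).hasFDerivAt.comp y
        (c.differentiableAt_emb hy).hasFDerivAt).clm_apply
        (c.differentiableAt_coordVec hy m).hasFDerivAt).fderiv
      change fderiv ℝ (fun y => (A ∘ c.emb) y (c.coordVec m y)) y _ = _
      rw [this]
      simp [c.fderiv_emb, add_comm]
    rw [extDer1, h, h, c.fderiv_coordVec_comm hy, curl_apply]
    ring
  have hBx' : curl A (c.emb z) (c.pos z) (c.coordVec k z) =
      r * A (c.emb z) (c.coordVec k z) := by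
    rw [c.pos_eq]
    exact hBx _ (hmem z) _
  rw [hflat, box1, extDer0, hdcod, c.codiff2_metric hz hB
    (fun v w => by rw [curl_apply, curl_apply]; ring) hF, hBx']
  have htr := c.trace_eq hz (LinearMap.mk₂ ℝ
    (fun v w => fderiv ℝ (curl A) (c.emb z) v w (c.coordVec k z))
    (by simp) (by simp) (by simp) (by simp))
  simp only [LinearMap.mk₂_apply, hDBx, hDBo] at htr
  rw [htr, ← toCLM_apply a]
  ring

end Setting

/-! ### Linearity and locality of the flat operators -/

section SecondDerivative

variable {E G : Type*} [NormedAddCommGroup E] [NormedSpace ℝ E] [NormedAddCommGroup G]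
  [NormedSpace ℝ G]

theorem fderiv_fderiv_add_smul {A B : E → G} {y : E} (hA : ContDiffAt ℝ ∞ A y)
    (hB : ContDiffAt ℝ ∞ B y) (k : ℝ) :
    fderiv ℝ (fderiv ℝ (A + k • B)) y =
      fderiv ℝ (fderiv ℝ A) y + k • fderiv ℝ (fderiv ℝ B) y := by
  have hev : ∀ {A : E → G}, ContDiffAt ℝ ∞ A y → ∀ᶠ z in nhds y, DifferentiableAt ℝ A z :=
    fun {A} hA => ((hA.of_le (m := 1) (by simp)).eventually (by simp)).mono
      fun z hz => hz.differentiableAt (by simp)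
  have h2 : ∀ {A : E → G}, ContDiffAt ℝ ∞ A y → DifferentiableAt ℝ (fderiv ℝ A) y :=
    fun {A} hA => (hA.fderiv_right (m := ∞) (by simp)).differentiableAt (by simp)
  have h : fderiv ℝ (A + k • B) =ᶠ[nhds y] fderiv ℝ A + k • fderiv ℝ B := by
    filter_upwards [hev hA, hev hB] with z hAz hBz
    rw [fderiv_add hAz (hBz.const_smul k), fderiv_const_smul hBz]
    rfl
  rw [h.fderiv_eq, fderiv_add (h2 hA) ((h2 hB).const_smul k), fderiv_const_smul (h2 hB)]

/-- Euler's relation. Small `t` suffices, and nothing more is available, since the dilation factor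
`1 + t` must stay positive. -/
theorem fderiv_apply_of_homogeneous {u : E → G} {y w : E} {r : ℝ} (hu : DifferentiableAt ℝ u y)
    (h : ∀ᶠ t : ℝ in nhds 0, u (y + t • w) = (1 + t) ^ r • u y) :
    fderiv ℝ u y w = r • u y := by
  have h1 : HasDerivAt (fun t : ℝ => y + t • w) w 0 := by
    simpa using ((hasDerivAt_id (0 : ℝ)).smul_const w).const_add y
  have hu' : HasFDerivAt u (fderiv ℝ u y) (y + (0 : ℝ) • w) := by
    simpa using hu.hasFDerivAt
  have h2 := hu'.comp_hasDerivAt (0 : ℝ) h1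
  have h3 : HasDerivAt (fun t : ℝ => (1 + t) ^ r • u y) (r • u y) 0 := by
    have h4 : HasDerivAt (fun t : ℝ => (1 + t) ^ r) r 0 := by
      simpa using ((hasDerivAt_id (0 : ℝ)).const_add 1).rpow_const (p := r) (by simp)
    exact h4.smul_const (u y)
  exact h2.unique (h3.congr_of_eventuallyEq h)

theorem fderiv_apply_of_invariant {u : E → G} {y w : E} (hu : DifferentiableAt ℝ u y)
    (h : ∀ t : ℝ, u (y + t • w) = u y) : fderiv ℝ u y w = 0 := by
  have := fderiv_apply_of_homogeneous (r := 0) hu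
    (Filter.Eventually.of_forall fun t => by rw [h t, Real.rpow_zero, one_smul])
  rwa [zero_smul] at this

end SecondDerivative

section Flat

variable {n : ℕ} {y : Amb n}

theorem flatBox0_eq_sum {u : Amb n → ℝ} (hu : ContDiffAt ℝ ∞ u y) :
    flatBox0 u y =
      ∑ α, etaSign α * fderiv ℝ (fderiv ℝ u) y (Pi.single α 1) (Pi.single α 1) := by
  have h : DifferentiableAt ℝ (fderiv ℝ u) y :=
    (hu.fderiv_right (m := ∞) (by simp)).differentiableAt (by simp)
  rw [flatBox0, box0, codiff1_etaMat (a := extDer0 u) h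
    (Filter.Eventually.of_forall fun _ _ => rfl), neg_neg]

/-- In Cartesian coordinates second derivatives commute, so `dδ` cancels the mixed part of `δd` and
the wave operator acts componentwise. Linearity and locality can then be read off. -/
theorem flatBox1_eq_sum {a : Amb n → Module.Dual ℝ (Amb n)} (ha : ContDiffAt ℝ ∞ (toCLM a) y)
    (v : Amb n) :
    flatBox1 a y v =
      ∑ α, etaSign α * fderiv ℝ (fderiv ℝ (toCLM a)) y (Pi.single α 1) (Pi.single α 1) v := by
  have hev : ∀ᶠ z in nhds y, DifferentiableAt ℝ (toCLM a) z :=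
    ((ha.of_le (m := 1) (by simp)).eventually (by simp)).mono
      fun z hz => hz.differentiableAt (by simp)
  have hd : DifferentiableAt ℝ (fderiv ℝ (toCLM a)) y :=
    (ha.fderiv_right (m := ∞) (by simp)).differentiableAt (by simp)
  have h1 : fderiv ℝ (codiff1 (fun _ => etaMat n) fun β z => a z (Pi.single β 1)) y v =
      -∑ α, etaSign α * fderiv ℝ (fderiv ℝ (toCLM a)) y v (Pi.single α 1) (Pi.single α 1) := by
    have h : (codiff1 (fun _ => etaMat n) fun β z => a z (Pi.single β 1)) =ᶠ[nhds y]
        fun z => -∑ α, etaSign α * fderiv ℝ (toCLM a) z (Pi.single α 1) (Pi.single α 1) :=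
      hev.mono fun z hz => codiff1_etaMat hz (Filter.Eventually.of_forall fun _ _ => rfl)
    rw [h.fderiv_eq]
    have h2 := (HasFDerivAt.fun_sum (u := Finset.univ) fun (α : Fin (n + 2)) _ =>
      ((hd.hasFDerivAt.clm_apply (hasFDerivAt_const (Pi.single α (1 : ℝ)) y)).clm_apply
      (hasFDerivAt_const (Pi.single α (1 : ℝ)) y)).const_mul (etaSign α)).neg.fderiv
    change fderiv ℝ (-fun z => _) y v = _
    rw [h2]
    simp
  have h3 : ∀ v w x : Amb n, fderiv ℝ (curl (toCLM a)) y v w x =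
      fderiv ℝ (fderiv ℝ (toCLM a)) y v w x - fderiv ℝ (fderiv ℝ (toCLM a)) y v x w := by
    intro v w x
    have h4 : DifferentiableAt ℝ (curl (toCLM a)) y :=
      (contDiffAt_curl ha).differentiableAt (by simp)
    have h5 := ((h4.hasFDerivAt.clm_apply (hasFDerivAt_const w y)).clm_apply
      (hasFDerivAt_const x y)).fderiv
    have h6 := (((hd.hasFDerivAt.clm_apply (hasFDerivAt_const w y)).clm_apply
      (hasFDerivAt_const x y)).sub ((hd.hasFDerivAt.clm_apply (hasFDerivAt_const x y)).clm_apply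
      (hasFDerivAt_const w y))).fderiv
    have h7 := congrArg (fun L : Amb n →L[ℝ] ℝ => L v) (h5.symm.trans h6)
    simpa using h7
  have hsymm : ∀ v w : Amb n, fderiv ℝ (fderiv ℝ (toCLM a)) y v w =
      fderiv ℝ (fderiv ℝ (toCLM a)) y w v := ha.isSymmSndFDerivAt (by
    rw [minSmoothness_of_isRCLikeNormedField]
    exact WithTop.coe_le_coe.2 (le_top (a := (2 : ℕ∞))))
  rw [(flatBox1_eq ha v).2, h1, neg_neg, ← Finset.sum_add_distrib]
  refine Finset.sum_congr rfl fun α _ => ?_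
  rw [h3, hsymm v]
  ring

theorem flatBox0_add_smul {u v : Amb n → ℝ} (hu : ContDiffAt ℝ ∞ u y) (hv : ContDiffAt ℝ ∞ v y)
    (k : ℝ) : flatBox0 (u + k • v) y = flatBox0 u y + k * flatBox0 v y := by
  have huv : ContDiffAt ℝ ∞ (u + k • v) y := hu.add (hv.const_smul k)
  rw [flatBox0_eq_sum huv, flatBox0_eq_sum hu, flatBox0_eq_sum hv,
    fderiv_fderiv_add_smul hu hv, Finset.mul_sum, ← Finset.sum_add_distrib]
  refine Finset.sum_congr rfl fun α _ => ?_
  simp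
  ring

theorem toCLM_add_smul (a b : Amb n → Module.Dual ℝ (Amb n)) (k : ℝ) :
    toCLM (a + k • b) = toCLM a + k • toCLM b := rfl

theorem flatBox1_add_smul {a b : Amb n → Module.Dual ℝ (Amb n)} (ha : ContDiffAt ℝ ∞ (toCLM a) y)
    (hb : ContDiffAt ℝ ∞ (toCLM b) y) (k : ℝ) (v : Amb n) :
    flatBox1 (a + k • b) y v = flatBox1 a y v + k * flatBox1 b y v := by
  have hab : ContDiffAt ℝ ∞ (toCLM (a + k • b)) y := ha.add (hb.const_smul k)
  rw [flatBox1_eq_sum hab, flatBox1_eq_sum ha, flatBox1_eq_sum hb, toCLM_add_smul,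
    fderiv_fderiv_add_smul ha hb, Finset.mul_sum, ← Finset.sum_add_distrib]
  refine Finset.sum_congr rfl fun α _ => ?_
  simp
  ring

theorem flatBox0_congr {u v : Amb n → ℝ} (hv : ContDiffAt ℝ ∞ v y) (h : u =ᶠ[nhds y] v) :
    flatBox0 u y = flatBox0 v y := by
  rw [flatBox0_eq_sum (hv.congr_of_eventuallyEq h), flatBox0_eq_sum hv, h.fderiv.fderiv_eq]

theorem flatBox1_congr {a b : Amb n → Module.Dual ℝ (Amb n)} (hb : ContDiffAt ℝ ∞ (toCLM b) y)
    (h : a =ᶠ[nhds y] b) (v : Amb n) : flatBox1 a y v = flatBox1 b y v := by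
  have h' : toCLM a =ᶠ[nhds y] toCLM b := h.mono fun z hz => by rw [toCLM, hz]; rfl
  rw [flatBox1_eq_sum (hb.congr_of_eventuallyEq h'), flatBox1_eq_sum hb, h'.fderiv.fderiv_eq]

end Flat

namespace Setting

variable {n : ℕ} (S : Setting n)

/-! ### The cylinder and the radial projection -/

/-- Up to the factor `H²`, the square of the radius of the projection to `P`. -/
noncomputable def quad (y : Amb n) : ℝ := -(S.ε * eta n (S.projLin y) (S.projLin y))

theorem mem_cylinder {y : Amb n} : y ∈ S.cylinder ↔ 0 < S.quad y := by
  rw [cylinder, Set.mem_ofPred_eq, proj_sub_origin, quad, neg_pos]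

theorem contDiff_quad : ContDiff ℝ ∞ S.quad :=
  contDiff_iff_contDiffAt.2 fun _ => (contDiffAt_const.mul
    (contDiffAt_eta S.projL.contDiff.contDiffAt S.projL.contDiff.contDiffAt)).neg

theorem isOpen_cylinder : IsOpen S.cylinder := by
  have : S.cylinder = S.quad ⁻¹' Set.Ioi 0 := Set.ext fun y => S.mem_cylinder
  rw [this]
  exact isOpen_Ioi.preimage S.contDiff_quad.continuous

theorem ε_mul_self : S.ε * S.ε = 1 := by
  rcases S.ε_eq with h | h <;> rw [h] <;> norm_num

theorem kap_inv : S.kap⁻¹ = S.ε * S.H ^ 2 := inv_inv _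

theorem projLin_of_mem {y : Amb n} (hy : y ∈ S.space) : S.projLin y = y - S.origin := by
  rw [projLin_apply, hy.2, one_smul]

theorem quad_of_mem {y : Amb n} (hy : y ∈ S.space) : S.quad y = (S.H ^ 2)⁻¹ := by
  rw [quad, S.projLin_of_mem hy, S.eta_position ⟨y, hy⟩]
  have h := S.H_pos.ne'
  have h1 := S.ε_mul_self
  have h2 : S.ε ≠ 0 := fun h => by simp [h] at h1
  field_simp

theorem space_subset_cylinder : S.space ⊆ S.cylinder := fun y hy => by
  rw [mem_cylinder, S.quad_of_mem hy]
  have := S.H_pos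
  positivity

theorem radius_proj {y : Amb n} (hy : y ∈ S.cylinder) :
    S.radius (S.proj y) = S.H * √(S.quad y) := by
  have h0 := S.mem_cylinder.1 hy
  rw [radius, proj_sub_origin]
  congr 2
  have h : |S.ε| = 1 := by rcases S.ε_eq with h | h <;> rw [h] <;> simp
  rw [← abs_of_pos h0, quad, abs_neg, abs_mul, h, one_mul]

theorem radius_proj_pos {y : Amb n} (hy : y ∈ S.cylinder) : 0 < S.radius (S.proj y) := by
  rw [S.radius_proj hy]
  exact mul_pos S.H_pos (Real.sqrt_pos.2 (S.mem_cylinder.1 hy))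

theorem radial_proj (y : Amb n) :
    S.radial (S.proj y) = S.origin + (S.radius (S.proj y))⁻¹ • S.projLin y := by
  rw [radial, proj_sub_origin]

theorem f_projLin (y : Amb n) : S.f (S.projLin y) = 0 := by
  rw [projLin_apply, map_sub, map_smul, f_origin, smul_eq_mul, mul_one, sub_self]

/-- Division by the radius normalises the position vector to square `-κ`, which cancels the square
`κ` of the orthogonal vector `S.origin`. -/
theorem radial_proj_mem {y : Amb n} (hy : y ∈ S.cylinder) : S.radial (S.proj y) ∈ S.space := by
  have h0 := S.mem_cylinder.1 hy
  have hR : S.radius (S.proj y) ^ 2 = S.H ^ 2 * S.quad y := by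
    rw [S.radius_proj hy, mul_pow, Real.sq_sqrt h0.le]
  have hE : eta n (S.projLin y) (S.projLin y) = -(S.ε * S.quad y) := by
    rw [quad]
    linear_combination (-eta n (S.projLin y) (S.projLin y)) * S.ε_mul_self
  have h1 := S.ε_mul_self
  have h2 : S.ε ≠ 0 := fun h => by simp [h] at h1
  have hH := S.H_pos.ne'
  constructor
  · rw [radial_proj]
    have h3 : ((S.radius (S.proj y))⁻¹) ^ 2 = (S.H ^ 2 * S.quad y)⁻¹ := by rw [inv_pow, hR]
    have h5 : eta n S.origin (S.projLin y) = 0 := by rw [eta_origin, f_projLin, mul_zero]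
    have h6 : eta n (S.projLin y) S.origin = 0 := by rw [eta_symm, h5]
    simp only [map_add, map_smul, LinearMap.add_apply, LinearMap.smul_apply, h5, h6,
      smul_eq_mul, hE, eta_origin, f_origin]
    have h4 : (S.ε * S.H ^ 2)⁻¹ * 1 + (S.H ^ 2 * S.quad y)⁻¹ * -(S.ε * S.quad y) = 0 := by
      field_simp
      linear_combination -h1
    linear_combination h4 - S.ε * S.quad y * h3
  · rw [radial_proj, map_add, map_smul, f_projLin, f_origin, smul_zero, add_zero]

theorem radius_proj_of_mem {y : Amb n} (hy : y ∈ S.space) : S.radius (S.proj y) = 1 := by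
  rw [S.radius_proj (S.space_subset_cylinder hy), S.quad_of_mem hy, Real.sqrt_inv,
    Real.sqrt_sq S.H_pos.le, mul_inv_cancel₀ S.H_pos.ne']

theorem radial_proj_of_mem {y : Amb n} (hy : y ∈ S.space) : S.radial (S.proj y) = y := by
  rw [radial_proj, S.radius_proj_of_mem hy, inv_one, one_smul, S.projLin_of_mem hy]
  abel

/-- The point of `Σₙ` on the radial half-line through the projection of a point of the cylinder. -/
noncomputable def foot {y : Amb n} (hy : y ∈ S.cylinder) : S.space :=
  ⟨S.radial (S.proj y), S.radial_proj_mem hy⟩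

/-- On the open cylinder the sign of the square is fixed, so the absolute value is the polynomial
`quad`, which is positive there. -/
theorem contDiffAt_radius {y : Amb n} (hy : y ∈ S.cylinder) :
    ContDiffAt ℝ ∞ (fun y => S.radius (S.proj y)) y := by
  have h : (fun y => S.radius (S.proj y)) =ᶠ[nhds y] fun y => S.H * √(S.quad y) :=
    Filter.eventually_of_mem (S.isOpen_cylinder.mem_nhds hy) fun y hy => S.radius_proj hy
  exact (contDiffAt_const.mul (S.contDiff_quad.contDiffAt.sqrt
    (S.mem_cylinder.1 hy).ne')).congr_of_eventuallyEq h

theorem contDiffAt_radial {y : Amb n} (hy : y ∈ S.cylinder) :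
    ContDiffAt ℝ ∞ (fun y => S.radial (S.proj y)) y := by
  simp only [radial_proj]
  exact contDiffAt_const.add (((S.contDiffAt_radius hy).inv (S.radius_proj_pos hy).ne').smul
    S.projL.contDiff.contDiffAt)

theorem contDiffAt_radius_rpow {y : Amb n} (hy : y ∈ S.cylinder) (r : ℝ) :
    ContDiffAt ℝ ∞ (fun y => S.radius (S.proj y) ^ r) y :=
  (S.contDiffAt_radius hy).rpow_const_of_ne (S.radius_proj_pos hy).ne'

/-! Dilations of `P` -/

theorem projLin_dilate (y : Amb n) (t : ℝ) :
    S.projLin (y + t • S.projLin y) = (1 + t) • S.projLin y := by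
  rw [map_add, map_smul, projLin_projLin, add_smul, one_smul]

theorem quad_dilate (y : Amb n) (t : ℝ) :
    S.quad (y + t • S.projLin y) = (1 + t) ^ 2 * S.quad y := by
  simp only [quad, projLin_dilate, map_smul, LinearMap.smul_apply, smul_eq_mul]
  ring

theorem dilate_mem {y : Amb n} (hy : y ∈ S.cylinder) {t : ℝ} (ht : 0 < 1 + t) :
    y + t • S.projLin y ∈ S.cylinder := by
  rw [mem_cylinder] at hy ⊢
  rw [quad_dilate]
  positivity

theorem radius_dilate {y : Amb n} (hy : y ∈ S.cylinder) {t : ℝ} (ht : 0 < 1 + t) :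
    S.radius (S.proj (y + t • S.projLin y)) = (1 + t) * S.radius (S.proj y) := by
  rw [S.radius_proj hy, S.radius_proj (S.dilate_mem hy ht), quad_dilate,
    Real.sqrt_mul (sq_nonneg _), Real.sqrt_sq ht.le]
  ring

theorem radial_dilate {y : Amb n} (hy : y ∈ S.cylinder) {t : ℝ} (ht : 0 < 1 + t) :
    S.radial (S.proj (y + t • S.projLin y)) = S.radial (S.proj y) := by
  have := ht.ne'
  rw [radial_proj, radial_proj, S.radius_dilate hy ht, projLin_dilate, smul_smul, mul_inv]
  congr 2
  field_simp

theorem proj_translate (y : Amb n) (t : ℝ) : S.proj (y + t • S.origin) = S.proj y := by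
  rw [← sub_left_inj (a := S.origin), proj_sub_origin, proj_sub_origin, map_add, map_smul,
    projLin_origin, smul_zero, add_zero]

theorem eventually_one_add_pos : ∀ᶠ t : ℝ in nhds 0, 0 < 1 + t := by
  filter_upwards [lt_mem_nhds (show (-1 : ℝ) < 0 by norm_num)] with t ht
  linarith

/-! ### The homogeneous extensions -/

variable {S}

theorem pullScalar_hom_eq (ψ : S.ScalarField) (r : ℝ) {y : Amb n} (hy : y ∈ S.cylinder) :
    S.pullScalar (ψ.hom r) y = S.radius (S.proj y) ^ r * ψ.toFun (S.foot hy) := by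
  rw [pullScalar, ScalarField.hom, dif_pos (S.radial_proj_mem hy), mul_comm]
  rfl

theorem pullScalar_hom_of_mem (ψ : S.ScalarField) (r : ℝ) (y : S.space) :
    S.pullScalar (ψ.hom r) y = ψ.toFun y := by
  rw [pullScalar_hom_eq ψ r (S.space_subset_cylinder y.2), S.radius_proj_of_mem y.2,
    Real.one_rpow, one_mul]
  exact congrArg ψ.toFun (Subtype.ext (S.radial_proj_of_mem y.2))

theorem contDiffOn_pullScalar_hom (ψ : S.ScalarField) (r : ℝ) :
    ContDiffOn ℝ ∞ (S.pullScalar (ψ.hom r)) S.cylinder := by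
  intro y hy
  refine ContDiffAt.contDiffWithinAt ?_
  -- A local ambient extension at the foot point, composed with the smooth radial projection,
  -- represents the field near `y`.
  obtain ⟨N, hN, hyN, B, hB, hBψ⟩ := ψ.smooth (S.foot hy)
  have hr := S.contDiffAt_radial hy
  have hBy : ContDiffAt ℝ ∞ B (S.radial (S.proj y)) := hB.contDiffAt (hN.mem_nhds hyN)
  refine ((S.contDiffAt_radius_rpow hy r).mul (hBy.comp y hr)).congr_of_eventuallyEq ?_
  filter_upwards [S.isOpen_cylinder.mem_nhds hy, hr.continuousAt.preimage_mem_nhds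
    (hN.mem_nhds hyN)] with z hz hzN
  rw [pullScalar_hom_eq ψ r hz, ← hBψ (S.foot hz) hzN]
  rfl

theorem scalarHomogeneous_hom (ψ : S.ScalarField) (r : ℝ) :
    S.ScalarHomogeneous r S.cylinder (S.pullScalar (ψ.hom r)) where
  smooth := contDiffOn_pullScalar_hom ψ r
  euler y hy := by
    have hd := ((contDiffOn_pullScalar_hom ψ r).contDiffAt
      (S.isOpen_cylinder.mem_nhds hy)).differentiableAt (by simp)
    refine fderiv_apply_of_homogeneous hd (eventually_one_add_pos.mono fun t ht => ?_)
    rw [pullScalar_hom_eq ψ r hy, pullScalar_hom_eq ψ r (S.dilate_mem hy ht),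
      S.radius_dilate hy ht, Real.mul_rpow ht.le (S.radius_proj_pos hy).le, smul_eq_mul,
      mul_assoc]
    congr 3
    exact Subtype.ext (S.radial_dilate hy ht)
  invariant y hy := by
    have hd := ((contDiffOn_pullScalar_hom ψ r).contDiffAt
      (S.isOpen_cylinder.mem_nhds hy)).differentiableAt (by simp)
    exact fderiv_apply_of_invariant hd fun t => by rw [pullScalar, pullScalar, proj_translate]

theorem coe_tangentProj (y : S.space) (v : Amb n) : (S.tangentProj y v : Amb n) =
    S.projLin v + (S.kap⁻¹ * eta n (y - S.origin) v) • ((y : Amb n) - S.origin) := by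
  simp only [tangentProj, S.eta_position, kap, LinearMap.codRestrict_apply, LinearMap.sub_apply,
    LinearMap.smulRight_apply, LinearMap.smul_apply, smul_eq_mul, inv_neg, neg_mul, neg_smul,
    sub_neg_eq_add]

theorem pullForm_hom_eq (b : S.OneForm) (r : ℝ) {y : Amb n} (hy : y ∈ S.cylinder) (v : Amb n) :
    S.pullForm (b.hom r) y v =
      S.radius (S.proj y) ^ (r - 1) * b.lift (S.foot hy) (S.projLin v) := by
  rw [pullForm, OneForm.hom, dif_pos (S.radial_proj_mem hy)]
  rfl

theorem OneForm.lift_of_mem (b : S.OneForm) (y : S.space) (v : S.tangent y) :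
    b.lift y v = b.toFun y v := by
  rw [OneForm.lift, LinearMap.comp_apply, tangentProj_of_mem]

theorem projLin_of_mem_tangent {y : S.space} {v : Amb n} (hv : v ∈ S.tangent y) :
    S.projLin v = v := by
  have h : S.f v = 0 := hv.2
  rw [projLin_apply, h, zero_smul, sub_zero]

theorem pullForm_hom_of_mem (b : S.OneForm) (r : ℝ) (y : S.space) {v : Amb n}
    (hv : v ∈ S.tangent y) : S.pullForm (b.hom r) y v = b.lift y v := by
  rw [pullForm_hom_eq b r (S.space_subset_cylinder y.2), S.radius_proj_of_mem y.2,
    Real.one_rpow, one_mul, projLin_of_mem_tangent hv]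
  exact congrArg (fun z => b.lift z v) (Subtype.ext (S.radial_proj_of_mem y.2))

theorem smoothFormOn_pullForm_hom (b : S.OneForm) (r : ℝ) :
    SmoothFormOn (S.pullForm (b.hom r)) S.cylinder := by
  intro v y hy
  refine ContDiffAt.contDiffWithinAt ?_
  obtain ⟨N, hN, hyN, B, hB, hBb⟩ := b.smooth (S.foot hy)
  have hr := S.contDiffAt_radial hy
  have hBy : ContDiffAt ℝ ∞ (toCLM B) (S.radial (S.proj y)) :=
    (contDiffOn_toCLM hB).contDiffAt (hN.mem_nhds hyN)
  have hp : ContDiffAt ℝ ∞ (fun z => S.radial (S.proj z) - S.origin) y := hr.sub contDiffAt_const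
  -- The argument given to `B` is the tangential projection of `S.projLin v` at the foot, written
  -- out by `coe_tangentProj`, so that its smooth dependence on the point is visible.
  refine ((S.contDiffAt_radius_rpow hy (r - 1)).mul ((hBy.comp y hr).clm_apply
    ((contDiffAt_const (c := S.projLin (S.projLin v))).add ((contDiffAt_const (c := S.kap⁻¹)).mul
      (contDiffAt_eta hp (contDiffAt_const (c := S.projLin v))) |>.smul
        hp)))).congr_of_eventuallyEq ?_
  filter_upwards [S.isOpen_cylinder.mem_nhds hy, hr.continuousAt.preimage_mem_nhds
    (hN.mem_nhds hyN)] with z hz hzN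
  rw [pullForm_hom_eq b r hz, OneForm.lift, LinearMap.comp_apply, ← hBb (S.foot hz) hzN,
    coe_tangentProj]
  rfl

theorem formHomogeneous_hom (b : S.OneForm) (r : ℝ) :
    S.FormHomogeneous r S.cylinder (S.pullForm (b.hom r)) where
  smooth := smoothFormOn_pullForm_hom b r
  euler y hy v := by
    have hd := ((contDiffOn_toCLM (smoothFormOn_pullForm_hom b r)).contDiffAt
      (S.isOpen_cylinder.mem_nhds hy)).differentiableAt (by simp)
    have h := fderiv_apply_of_homogeneous (w := S.projLin y) (r := r - 1) hd
      (eventually_one_add_pos.mono fun t ht => by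
        ext v
        rw [smul_apply, toCLM_apply, toCLM_apply, pullForm_hom_eq b r hy,
          pullForm_hom_eq b r (S.dilate_mem hy ht), S.radius_dilate hy ht,
          Real.mul_rpow ht.le (S.radius_proj_pos hy).le, smul_eq_mul, mul_assoc]
        have : S.foot (S.dilate_mem hy ht) = S.foot hy := Subtype.ext (S.radial_dilate hy ht)
        rw [this])
    rw [h]
    rfl
  invariant y hy v := by
    have hd := ((contDiffOn_toCLM (smoothFormOn_pullForm_hom b r)).contDiffAt
      (S.isOpen_cylinder.mem_nhds hy)).differentiableAt (by simp)
    rw [fderiv_apply_of_invariant hd fun t => by rw [toCLM, toCLM, pullForm, pullForm,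
      proj_translate]]
    rfl
  radial y hy := by
    have hx : S.projLin y = S.radius (S.proj y) • ((S.foot hy : Amb n) - S.origin) := by
      change _ = _ • (S.radial (S.proj y) - S.origin)
      rw [radial_proj, add_sub_cancel_left, smul_smul,
        mul_inv_cancel₀ (S.radius_proj_pos hy).ne', one_smul]
    -- The position vector is normal to `Σₙ`, hence killed by the tangential projection built into
    -- `lift`.
    have h0 : S.tangentProj (S.foot hy) ((S.foot hy : Amb n) - S.origin) = 0 := by
      apply Subtype.ext
      rw [coe_tangentProj, S.eta_position, ← kap, map_sub, projLin_origin, sub_zero,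
        S.projLin_of_mem (S.foot hy).2, mul_neg, inv_mul_cancel₀ S.kap_ne]
      simp
    rw [pullForm_hom_eq b r hy, projLin_projLin, hx, map_smul, OneForm.lift,
      LinearMap.comp_apply, h0]
    simp
  normal y hy := by
    rw [pullForm_hom_eq b r hy, projLin_origin, map_zero, mul_zero]

end Setting

namespace Setting

variable {n : ℕ} {S : Setting n}

/-! ### The extensions on the cylinder -/

theorem pullScalar_scalarExt (χ : S.ScalarField → S.ScalarField) (s : ℝ) (ψ : S.ScalarField) :
    S.pullScalar (S.scalarExt χ s ψ) = S.pullScalar (ψ.hom 0) +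
      (-(S.ε * (S.H ^ 2)⁻¹)) • S.pullScalar ((χ ψ).hom s) +
      (S.ε * (S.H ^ 2)⁻¹) • S.pullScalar ((χ ψ).hom 0) := by
  funext y
  simp only [pullScalar, scalarExt, Pi.add_apply, Pi.smul_apply, smul_eq_mul]
  ring

theorem pullForm_formExt (χ : S.OneForm → S.OneForm) (s : ℝ) (b : S.OneForm) :
    S.pullForm (S.formExt χ s b) = S.pullForm (b.hom 0) +
      (-(S.ε * (S.H ^ 2)⁻¹)) • S.pullForm ((χ b).hom s) +
      (S.ε * (S.H ^ 2)⁻¹) • S.pullForm ((χ b).hom 0) := by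
  funext y
  ext v
  simp only [pullForm, formExt, Pi.add_apply, Pi.smul_apply, LinearMap.add_apply,
    LinearMap.smul_apply, LinearMap.sub_apply, LinearMap.comp_apply, smul_eq_mul]
  ring

theorem contDiffAt_toCLM_hom (b : S.OneForm) (r : ℝ) {y : Amb n} (hy : y ∈ S.cylinder) :
    ContDiffAt ℝ ∞ (toCLM (S.pullForm (b.hom r))) y :=
  (contDiffOn_toCLM (smoothFormOn_pullForm_hom b r)).contDiffAt (S.isOpen_cylinder.mem_nhds hy)

theorem contDiffAt_scalar_hom (ψ : S.ScalarField) (r : ℝ) {y : Amb n} (hy : y ∈ S.cylinder) :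
    ContDiffAt ℝ ∞ (S.pullScalar (ψ.hom r)) y :=
  (contDiffOn_pullScalar_hom ψ r).contDiffAt (S.isOpen_cylinder.mem_nhds hy)

theorem isScalarExtension_scalarExt (χ : S.ScalarField → S.ScalarField) (s : ℝ)
    (ψ : S.ScalarField) :
    IsScalarExtension ψ S.cylinder (S.pullScalar (S.scalarExt χ s ψ)) := by
  rw [pullScalar_scalarExt]
  refine ⟨((contDiffOn_pullScalar_hom ψ 0).add ((contDiffOn_pullScalar_hom (χ ψ) s).const_smul
    (-(S.ε * (S.H ^ 2)⁻¹)))).add ((contDiffOn_pullScalar_hom (χ ψ) 0).const_smul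
    (S.ε * (S.H ^ 2)⁻¹)), fun y => ?_⟩
  simp only [Pi.add_apply, Pi.smul_apply, pullScalar_hom_of_mem, smul_eq_mul]
  ring

theorem isFormExtension_formExt (χ : S.OneForm → S.OneForm) (s : ℝ) (b : S.OneForm) :
    IsFormExtension b S.cylinder (S.pullForm (S.formExt χ s b)) := by
  rw [pullForm_formExt]
  refine ⟨fun v => ((smoothFormOn_pullForm_hom b 0 v).add ((smoothFormOn_pullForm_hom (χ b) s
    v).const_smul (-(S.ε * (S.H ^ 2)⁻¹)))).add ((smoothFormOn_pullForm_hom (χ b) 0 v).const_smul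
    (S.ε * (S.H ^ 2)⁻¹)), fun y v => ?_⟩
  simp only [Pi.add_apply, Pi.smul_apply, LinearMap.add_apply, LinearMap.smul_apply,
    pullForm_hom_of_mem _ _ y v.2, OneForm.lift_of_mem, smul_eq_mul]
  ring

theorem ε_H_inv_mul_kap_inv : S.ε * (S.H ^ 2)⁻¹ * S.kap⁻¹ = 1 := by
  have h := S.H_pos.ne'
  have h1 := S.ε_mul_self
  rw [kap_inv]
  field_simp
  linear_combination h1

/-- The intrinsic operators on `χ ψ` from degrees `s` and `0` cancel. What is left is `s (s + n - 1)
χ ψ`, by `ε_H_inv_mul_kap_inv`, and the equation for `s` makes the factor one. -/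
theorem scalarBoxEq_scalarExt (χ : S.ScalarField → S.ScalarField) {s : ℝ}
    (hs : s ^ 2 + ((n : ℝ) - 1) * s = 1) (ψ : S.ScalarField) :
    ScalarBoxEq (S.pullScalar (S.scalarExt χ s ψ)) ψ (χ ψ) := by
  intro c x hx
  have hmem : c.emb x ∈ S.cylinder := S.space_subset_cylinder (c.φ x).2
  have h := fun (ψ : S.ScalarField) r => (scalarHomogeneous_hom ψ r).flatBox0_eq S.isOpen_cylinder
    S.space_subset_cylinder c hx (b := fun z => ψ.toFun (c.φ z))
    (fun y _ => (pullScalar_hom_of_mem ψ r (c.φ y)).symm)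
  have h0 := contDiffAt_scalar_hom ψ 0 hmem
  have h1 := contDiffAt_scalar_hom (χ ψ) s hmem
  have h2 := contDiffAt_scalar_hom (χ ψ) 0 hmem
  have h01 : ContDiffAt ℝ ∞ (S.pullScalar (ψ.hom 0) +
      (-(S.ε * (S.H ^ 2)⁻¹)) • S.pullScalar ((χ ψ).hom s)) (c.emb x) := h0.add (h1.const_smul (-(S.ε * (S.H ^ 2)⁻¹)))
  have hv : S.pullScalar ((χ ψ).hom s) (c.emb x) = (χ ψ).toFun (c.φ x) :=
    pullScalar_hom_of_mem _ _ (c.φ x)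
  change flatBox0 _ (c.emb x) = _
  rw [pullScalar_scalarExt, flatBox0_add_smul h01 h2,
    flatBox0_add_smul h0 h1, h ψ 0, h (χ ψ) s, h (χ ψ) 0, hv]
  have hk := ε_H_inv_mul_kap_inv (S := S)
  simp only [LocalParam.boxScalar]
  linear_combination (s * (s + (n - 1)) * (χ ψ).toFun (c.φ x)) * hk +
    (χ ψ).toFun (c.φ x) * hs

/-- The same cancellation as for functions, with the one-form factor `s (s + n - 3)`. -/
theorem formBoxEq_formExt (χ : S.OneForm → S.OneForm) {s : ℝ}
    (hs : s ^ 2 + ((n : ℝ) - 3) * s = 1) (b : S.OneForm) :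
    FormBoxEq (S.pullForm (S.formExt χ s b)) b (χ b) := by
  intro c x hx i
  have hmem : c.emb x ∈ S.cylinder := S.space_subset_cylinder (c.φ x).2
  have h := fun (b : S.OneForm) r => (formHomogeneous_hom b r).flatBox1_eq S.isOpen_cylinder
    S.space_subset_cylinder c hx (b := fun j z => b.lift (c.φ z) (c.coordVec j z))
    (fun y hy j => (pullForm_hom_of_mem b r (c.φ y) (c.coordVec_mem hy j)).symm) i
  have h0 := contDiffAt_toCLM_hom b 0 hmem
  have h1 := contDiffAt_toCLM_hom (χ b) s hmem
  have h2 := contDiffAt_toCLM_hom (χ b) 0 hmem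
  have h01 : ContDiffAt ℝ ∞ (toCLM (S.pullForm (b.hom 0) +
      (-(S.ε * (S.H ^ 2)⁻¹)) • S.pullForm ((χ b).hom s))) (c.emb x) :=
    h0.add (h1.const_smul (-(S.ε * (S.H ^ 2)⁻¹)))
  have hv : S.pullForm ((χ b).hom s) (c.emb x) (c.coordVec i x) =
      (χ b).lift (c.φ x) (c.coordVec i x) :=
    pullForm_hom_of_mem _ _ (c.φ x) (c.coordVec_mem hx i)
  change flatBox1 _ (c.emb x) _ = _
  rw [pullForm_formExt, flatBox1_add_smul h01 h2,
    flatBox1_add_smul h0 h1, h b 0, h (χ b) s, h (χ b) 0, hv]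
  have hk := ε_H_inv_mul_kap_inv (S := S)
  simp only [LocalParam.boxForm]
  linear_combination (s * (s + (n - 3)) * (χ b).lift (c.φ x) (c.coordVec i x)) * hk +
    (χ b).lift (c.φ x) (c.coordVec i x) * hs

/-! ### Extensions to the whole ambient space -/

variable (S) in
/-- A smooth function that is `1` near `Σₙ` and is supported in the cylinder. -/
noncomputable def cutoff (y : Amb n) : ℝ := Real.smoothTransition (4 * (S.H ^ 2 * S.quad y) - 1)

theorem contDiff_cutoff : ContDiff ℝ ∞ S.cutoff :=
  Real.smoothTransition.contDiff.comp
    ((contDiff_const.mul (contDiff_const.mul S.contDiff_quad)).sub contDiff_const)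

theorem cutoff_eventually_one {y : Amb n} (hy : y ∈ S.space) : ∀ᶠ z in nhds y, S.cutoff z = 1 := by
  have hc : ContinuousAt (fun z => 4 * (S.H ^ 2 * S.quad z) - 1) y :=
    (((S.contDiff_quad.continuous.const_mul _).const_mul _).sub continuous_const).continuousAt
  -- On `Σₙ` one has `H² quad = 1`, so the argument is `3`, well inside the region where the
  -- transition function is one; off the cylinder it is at most `-1`.
  have h3 : 1 < 4 * (S.H ^ 2 * S.quad y) - 1 := by
    rw [S.quad_of_mem hy, mul_inv_cancel₀ (pow_ne_zero 2 S.H_pos.ne')]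
    norm_num
  filter_upwards [hc.eventually (lt_mem_nhds h3)] with z hz
  exact Real.smoothTransition.one_of_one_le hz.le

theorem cutoff_eventually_zero {y : Amb n} (hy : y ∉ S.cylinder) :
    ∀ᶠ z in nhds y, S.cutoff z = 0 := by
  have hc : ContinuousAt (fun z => 4 * (S.H ^ 2 * S.quad z) - 1) y :=
    (((S.contDiff_quad.continuous.const_mul _).const_mul _).sub continuous_const).continuousAt
  rw [mem_cylinder, not_lt] at hy
  have h3 : 4 * (S.H ^ 2 * S.quad y) - 1 < 0 := by
    have := mul_nonpos_of_nonneg_of_nonpos (sq_nonneg S.H) hy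
    linarith
  filter_upwards [hc.eventually (gt_mem_nhds h3)] with z hz
  exact Real.smoothTransition.zero_of_nonpos hz.le

/-- Nothing is known about `u` off the cylinder. The product is smooth there because the cutoff
vanishes on a whole neighbourhood of each such point. -/
theorem contDiff_cutoff_mul {u : Amb n → ℝ} (hu : ContDiffOn ℝ ∞ u S.cylinder) :
    ContDiff ℝ ∞ fun y => S.cutoff y * u y := by
  rw [contDiff_iff_contDiffAt]
  intro y
  by_cases hy : y ∈ S.cylinder
  · exact contDiff_cutoff.contDiffAt.mul (hu.contDiffAt (S.isOpen_cylinder.mem_nhds hy))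
  · refine (contDiffAt_const (c := (0 : ℝ))).congr_of_eventuallyEq ?_
    filter_upwards [cutoff_eventually_zero hy] with z hz
    rw [hz, zero_mul]

theorem exists_global_scalar {ψ ξ : S.ScalarField} {u : Amb n → ℝ}
    (hu : IsScalarExtension ψ S.cylinder u) (hbox : ScalarBoxEq u ψ ξ) :
    ∃ w : Amb n → ℝ, IsScalarExtension ψ Set.univ w ∧ ScalarBoxEq w ψ ξ := by
  have hev : ∀ y ∈ S.space, (fun y => S.cutoff y * u y) =ᶠ[nhds y] u := fun y hy =>
    (cutoff_eventually_one hy).mono fun z hz => by simp only [hz, one_mul]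
  refine ⟨fun y => S.cutoff y * u y, ⟨(contDiff_cutoff_mul hu.1).contDiffOn, fun y => ?_⟩,
    fun c x hx => ?_⟩
  · exact (hev y y.2).eq_of_nhds.trans (hu.2 y)
  · rw [← hbox c x hx]
    exact flatBox0_congr (hu.1.contDiffAt (S.isOpen_cylinder.mem_nhds
      (S.space_subset_cylinder (c.φ x).2))) (hev _ (c.φ x).2)

theorem exists_global_form {b ξ : S.OneForm} {a : Amb n → Module.Dual ℝ (Amb n)}
    (ha : IsFormExtension b S.cylinder a) (hbox : FormBoxEq a b ξ) :
    ∃ w : Amb n → Module.Dual ℝ (Amb n), IsFormExtension b Set.univ w ∧ FormBoxEq w b ξ := by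
  have hev : ∀ y ∈ S.space, (fun y => S.cutoff y • a y) =ᶠ[nhds y] a := fun y hy =>
    (cutoff_eventually_one hy).mono fun z hz => by simp only [hz, one_smul]
  refine ⟨fun y => S.cutoff y • a y, ⟨fun v => (contDiff_cutoff_mul (ha.1 v)).contDiffOn,
    fun y v => ?_⟩, fun c x hx i => ?_⟩
  · exact (LinearMap.congr_fun (hev y y.2).eq_of_nhds v).trans (ha.2 y v)
  · rw [← hbox c x hx i]
    exact flatBox1_congr ((contDiffOn_toCLM ha.1).contDiffAt (S.isOpen_cylinder.mem_nhds
      (S.space_subset_cylinder (c.φ x).2))) (hev _ (c.φ x).2) _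

theorem exists_degree (k : ℝ) : ∃ s : ℝ, s ^ 2 + k * s = 1 := by
  -- The larger root; the discriminant `k² + 4` is always positive.
  refine ⟨(-k + √(k ^ 2 + 4)) / 2, ?_⟩
  have h : √(k ^ 2 + 4) ^ 2 = k ^ 2 + 4 := Real.sq_sqrt (by positivity)
  linear_combination h / 4

end Setting

end AdSExt

/-! ### Assembly of the theorem. -/

theorem mainTheorem3 (n : ℕ) (S : AdSExt.Setting n) :
    (IsOpen S.cylinder ∧ S.space ⊆ S.cylinder) ∧
    (∀ χ : S.OneForm → S.OneForm,
      (∃ ϖ : S.OneForm → (AdSExt.Amb n → Module.Dual ℝ (AdSExt.Amb n)),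
        ∀ β : S.OneForm,
          AdSExt.Setting.IsFormExtension β Set.univ (ϖ β) ∧
          AdSExt.Setting.FormBoxEq (ϖ β) β (χ β)) ∧
      (∃ s : ℝ, s ^ 2 + ((n : ℝ) - 3) * s = 1) ∧
      (∀ s : ℝ, s ^ 2 + ((n : ℝ) - 3) * s = 1 → ∀ β : S.OneForm,
          AdSExt.Setting.IsFormExtension β S.cylinder (S.pullForm (S.formExt χ s β)) ∧
          AdSExt.Setting.FormBoxEq (S.pullForm (S.formExt χ s β)) β (χ β))) ∧
    (∀ χ : S.ScalarField → S.ScalarField,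
      (∃ ϖ : S.ScalarField → (AdSExt.Amb n → ℝ),
        ∀ β : S.ScalarField,
          AdSExt.Setting.IsScalarExtension β Set.univ (ϖ β) ∧
          AdSExt.Setting.ScalarBoxEq (ϖ β) β (χ β)) ∧
      (∃ s : ℝ, s ^ 2 + ((n : ℝ) - 1) * s = 1) ∧
      (∀ s : ℝ, s ^ 2 + ((n : ℝ) - 1) * s = 1 → ∀ β : S.ScalarField,
          AdSExt.Setting.IsScalarExtension β S.cylinder (S.pullScalar (S.scalarExt χ s β)) ∧
          AdSExt.Setting.ScalarBoxEq (S.pullScalar (S.scalarExt χ s β)) β (χ β))) := by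
  refine ⟨⟨S.isOpen_cylinder, S.space_subset_cylinder⟩, fun χ => ⟨?_, ?_, ?_⟩,
    fun χ => ⟨?_, ?_, ?_⟩⟩
  · obtain ⟨s, hs⟩ := AdSExt.Setting.exists_degree ((n : ℝ) - 3)
    choose ϖ hϖ using fun β : S.OneForm => AdSExt.Setting.exists_global_form
      (AdSExt.Setting.isFormExtension_formExt χ s β) (AdSExt.Setting.formBoxEq_formExt χ hs β)
    exact ⟨ϖ, hϖ⟩
  · exact AdSExt.Setting.exists_degree _
  · exact fun s hs β => ⟨AdSExt.Setting.isFormExtension_formExt χ s β,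
      AdSExt.Setting.formBoxEq_formExt χ hs β⟩
  · obtain ⟨s, hs⟩ := AdSExt.Setting.exists_degree ((n : ℝ) - 1)
    choose ϖ hϖ using fun β : S.ScalarField => AdSExt.Setting.exists_global_scalar
      (AdSExt.Setting.isScalarExtension_scalarExt χ s β)
      (AdSExt.Setting.scalarBoxEq_scalarExt χ hs β)
    exact ⟨ϖ, hϖ⟩
  · exact AdSExt.Setting.exists_degree _
  · exact fun s hs β => ⟨AdSExt.Setting.isScalarExtension_scalarExt χ s β,
      AdSExt.Setting.scalarBoxEq_scalarExt χ hs β⟩
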